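/- Let $H_*(\mathbf{Z}^6)$ and $H^*(\mathbf{Z}^6)$ denote the integral homology and cohomology of the group $\mathbf{Z}^6$ (equivalently, of the torus $T^6=K(\mathbf{Z}^6,1)$). Fix a basis $\gamma_1,\dots,\gamma_6$ of $H_1(\mathbf{Z}^6)=\mathbf{Z}^6$, let $x_1,\dots,x_6\in H^1(\mathbf{Z}^6)=\operatorname{Hom}(\mathbf{Z}^6,\mathbf{Z})$ be the dual basis, and let $[T]\in H_6(\mathbf{Z}^6)\cong\mathbf{Z}$ be the orientation class of $T^6$ determined by $\gamma_1,\dots,\gamma_6$, i.e. the product of the classes of the coordinate circles $\gamma_1,\dots,\gamma_6$ in this order. Write $x_ix_j\in H^2(\mathbf{Z}^6)$ for the cup product. For integers $a,b,c$, the notation $a\mid b\mid c$ means that there are integers $k,\ell$ with $b=ak$ and $c=b\ell$. **Theorem.** For every $\alpha\in H_4(\mathbf{Z}^6)$ there is exactly one triple of integers $(a,b,c)$ with $a\mid b\mid c$ and $a,b\ge 0$ for which there exists an automorphism $A\in\operatorname{Aut}(\mathbf{Z}^6)$ such that the induced map $A_*\colon H_4(\mathbf{Z}^6)\to H_4(\mathbf{Z}^6)$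 satisfies $$A_*(\alpha)=(a\,x_1x_2+b\,x_3x_4+c\,x_5x_6)\cap[T].$$ -/

import Mathlib

set_option linter.unusedSectionVars false

noncomputable section

namespace TorusHomology

open CategoryTheory Finsupp

/-! ## Integral homology and cohomology of a discrete group

Both are Mathlib's: the (co)homology of the complex of inhomogeneous (bar) (co)chains of `G`, with
coefficients in the trivial module `ℤ`. -/

/-- The homology group `Hₙ(G; ℤ)`. -/
abbrev H (n : ℕ) (G : Type) [Group G] : ModuleCat.{0} ℤ :=
  groupHomology (Rep.trivial ℤ G ℤ) n

/-- The cohomology group `Hⁿ(G; ℤ)`. -/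
abbrev coH (n : ℕ) (G : Type) [Group G] : ModuleCat.{0} ℤ :=
  groupCohomology (Rep.trivial ℤ G ℤ) n

/-- The map `f_* : Hₙ(G; ℤ) → Hₙ(G'; ℤ)` induced by a group homomorphism `f`. -/
def pushforward {G G' : Type} [Group G] [Group G'] (f : G →* G') (n : ℕ) :
    H n G →ₗ[ℤ] H n G' :=
  (groupHomology.map (A := Rep.trivial ℤ G ℤ) (B := Rep.trivial ℤ G' ℤ) f
    (Rep.ofHom ⟨LinearMap.id, fun _ => rfl⟩) n).hom

section

variable {G : Type} [Group G]

/-- The boundary operator of the bar complex,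
`∂[g₁|…|gₙ₊₁] = [g₂|…|gₙ₊₁] + ∑ⱼ (-1)ʲ [g₁|…|gⱼgⱼ₊₁|…|gₙ₊₁] + (-1)ⁿ⁺¹ [g₁|…|gₙ]`. -/
abbrev bd (n : ℕ) : ((Fin (n + 1) → G) →₀ ℤ) →ₗ[ℤ] ((Fin n → G) →₀ ℤ) :=
  (groupHomology.inhomogeneousChains.d (Rep.trivial ℤ G ℤ) n).hom

/-- The coboundary operator of the inhomogeneous cochain complex. -/
abbrev cobd (n : ℕ) : ((Fin n → G) → ℤ) →ₗ[ℤ] ((Fin (n + 1) → G) → ℤ) :=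
  (inhomogeneousCochains.d (Rep.trivial ℤ G ℤ) n).hom

lemma bd_single (n : ℕ) (g : Fin (n + 1) → G) :
    bd n (single g 1) = single (fun i => g i.succ) 1 +
      ∑ j : Fin (n + 1), (-1 : ℤ) ^ ((j : ℕ) + 1) • single (Fin.contractNth j (· * ·) g) 1 := by
  exact groupHomology.inhomogeneousChains.d_single (A := Rep.trivial ℤ G ℤ) n g 1

lemma cobd_apply (n : ℕ) (φ : (Fin n → G) → ℤ) (g : Fin (n + 1) → G) :
    cobd n φ g = φ (fun i => g i.succ) +
      ∑ j : Fin (n + 1), (-1 : ℤ) ^ ((j : ℕ) + 1) • φ (Fin.contractNth j (· * ·) g) := rfl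

/-- A chain is a cycle if its boundary vanishes; every `0`-chain is a cycle. -/
def IsCycle : (n : ℕ) → ((Fin n → G) →₀ ℤ) → Prop
  | 0, _ => True
  | n + 1, z => bd n z = 0

/-- A cochain is a coboundary if it is `δχ` for some `χ` of one degree less; in degree `0` only
`0` is. -/
def IsCoboundary : (n : ℕ) → ((Fin n → G) → ℤ) → Prop
  | 0, φ => φ = 0
  | n + 1, φ => ∃ χ, cobd n χ = φ

/-- The homology class of a cycle. -/
def cls (n : ℕ) (z : (Fin n → G) →₀ ℤ) (hz : IsCycle n z) : H n G :=
  groupHomology.π (Rep.trivial ℤ G ℤ) n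
    (groupHomology.cyclesMk (A := Rep.trivial ℤ G ℤ) n _ rfl z (by
      cases n with
      | zero =>
        rw [(groupHomology.inhomogeneousChains (Rep.trivial ℤ G ℤ)).shape 0 _ (by simp)]
        rfl
      | succ n =>
        have e : (ComplexShape.down ℕ).next (n + 1) = n := ChainComplex.next_nat_succ n
        rw [e, groupHomology.inhomogeneousChains.d_def]
        exact hz))

/-- The cohomology class of a cocycle. -/
def cocls (n : ℕ) (φ : (Fin n → G) → ℤ) (hφ : cobd n φ = 0) : coH n G :=
  groupCohomology.π (Rep.trivial ℤ G ℤ) n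
    (groupCohomology.cocyclesMk (A := Rep.trivial ℤ G ℤ) φ (by exact hφ))

lemma π_eq_zero_iff {ι : Type} {c : ComplexShape ι} (K : HomologicalComplex (ModuleCat.{0} ℤ) c)
    (i : ι) (z : K.cycles i) :
    K.homologyπ i z = 0 ↔ ∃ w : K.X (c.prev i), K.d (c.prev i) i w = K.iCycles i z := by
  have hinj : Function.Injective (K.iCycles i) := (ModuleCat.mono_iff_injective _).1 inferInstance
  have hex := ShortComplex.exact_of_g_is_cokernel
    (ShortComplex.mk _ _ (K.toCycles_comp_homologyπ (c.prev i) i))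
    (K.homologyIsCokernel (c.prev i) i rfl)
  rw [ShortComplex.moduleCat_exact_iff] at hex
  constructor
  · intro h
    obtain ⟨w, hw⟩ := hex z h
    refine ⟨w, ?_⟩
    have hw' : K.toCycles (c.prev i) i w = z := hw
    rw [← hw', ← ModuleCat.comp_apply, K.toCycles_i]
  · rintro ⟨w, hw⟩
    have : K.toCycles (c.prev i) i w = z := by
      apply hinj
      rw [← hw, ← ModuleCat.comp_apply, K.toCycles_i]
    rw [← this, ← ModuleCat.comp_apply, K.toCycles_comp_homologyπ]
    rfl


lemma exists_cls {n : ℕ} (x : H n G) : ∃ z hz, cls n z hz = x := by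
  induction x using groupHomology_induction_on with
  | h x =>
    set K := groupHomology.inhomogeneousChains (Rep.trivial ℤ G ℤ)
    have hc (j : ℕ) : K.d n j (K.iCycles n x) = 0 := by
      rw [← ModuleCat.comp_apply, K.iCycles_d]; rfl
    have hz : IsCycle n (K.iCycles n x) := by
      cases n with
      | zero => trivial
      | succ n =>
        have := hc n
        rw [groupHomology.inhomogeneousChains.d_def] at this
        exact this
    refine ⟨_, hz, ?_⟩
    refine congrArg _ ((ModuleCat.mono_iff_injective (K.iCycles n)).1 inferInstance ?_)
    exact groupHomology.iCycles_mk ..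

lemma exists_cocls {n : ℕ} (x : coH n G) : ∃ φ hφ, cocls n φ hφ = x := by
  induction x using groupCohomology_induction_on with
  | h x =>
    set K := groupCohomology.inhomogeneousCochains (Rep.trivial ℤ G ℤ)
    have hc : K.d n (n + 1) (K.iCycles n x) = 0 := by
      rw [← ModuleCat.comp_apply, K.iCycles_d]; rfl
    rw [groupCohomology.inhomogeneousCochains.d_def] at hc
    refine ⟨_, hc, ?_⟩
    refine congrArg _ ((ModuleCat.mono_iff_injective (K.iCycles n)).1 inferInstance ?_)
    exact groupCohomology.iCocycles_mk ..

lemma IsCycle.sub {n : ℕ} {z z' : (Fin n → G) →₀ ℤ} (h : IsCycle n z) (h' : IsCycle n z') :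
    IsCycle n (z - z') := by
  cases n with
  | zero => trivial
  | succ n => exact (map_sub _ _ _).trans (by 
      rw [show bd n z = 0 from h, show bd n z' = 0 from h', sub_zero])

lemma cls_eq_zero_iff {n : ℕ} {z : (Fin n → G) →₀ ℤ} (h : IsCycle n z) :
    cls n z h = 0 ↔ ∃ w, bd n w = z := by
  refine (π_eq_zero_iff _ _ _).trans ?_
  erw [groupHomology.iCycles_mk]
  rw [ChainComplex.prev, groupHomology.inhomogeneousChains.d_def]

lemma cls_eq_iff {n : ℕ} {z z' : (Fin n → G) →₀ ℤ} (h : IsCycle n z) (h' : IsCycle n z') :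
    cls n z h = cls n z' h' ↔ ∃ w, bd n w = z - z' := by
  rw [← cls_eq_zero_iff (h.sub h'), ← sub_eq_zero]
  refine Eq.congr_left ?_
  refine (map_sub (groupHomology.π (Rep.trivial ℤ G ℤ) n).hom _ _).symm.trans ?_
  refine congrArg (groupHomology.π (Rep.trivial ℤ G ℤ) n) ?_
  apply (ModuleCat.mono_iff_injective (groupHomology.iCycles (Rep.trivial ℤ G ℤ) n)).1 inferInstance
  refine (map_sub (groupHomology.iCycles (Rep.trivial ℤ G ℤ) n).hom _ _).trans ?_
  erw [groupHomology.iCycles_mk, groupHomology.iCycles_mk, groupHomology.iCycles_mk]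

lemma cobd_sub_eq_zero {n : ℕ} {φ φ' : (Fin n → G) → ℤ} (h : cobd n φ = 0) (h' : cobd n φ' = 0) :
    cobd n (φ - φ') = 0 :=
  (map_sub _ _ _).trans (by rw [h, h', sub_zero])

lemma cocls_eq_zero_iff {n : ℕ} {φ : (Fin n → G) → ℤ} (h : cobd n φ = 0) :
    cocls n φ h = 0 ↔ IsCoboundary n φ := by
  refine (π_eq_zero_iff _ _ _).trans ?_
  erw [groupCohomology.iCocycles_mk]
  cases n with
  | zero =>
    rw [(groupCohomology.inhomogeneousCochains (Rep.trivial ℤ G ℤ)).shape _ 0 (by simp)]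
    exact ⟨fun ⟨_, h⟩ => h.symm, fun h => ⟨0, h.symm⟩⟩
  | succ n =>
    rw [CochainComplex.prev_nat_succ, groupCohomology.inhomogeneousCochains.d_def]
    rfl

lemma cocls_eq_iff {n : ℕ} {φ φ' : (Fin n → G) → ℤ} (h : cobd n φ = 0) (h' : cobd n φ' = 0) :
    cocls n φ h = cocls n φ' h' ↔ IsCoboundary n (φ - φ') := by
  rw [← cocls_eq_zero_iff (cobd_sub_eq_zero h h'), ← sub_eq_zero]
  refine Eq.congr_left ?_
  refine (map_sub (groupCohomology.π (Rep.trivial ℤ G ℤ) n).hom _ _).symm.trans ?_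
  refine congrArg (groupCohomology.π (Rep.trivial ℤ G ℤ) n) ?_
  apply (ModuleCat.mono_iff_injective
    (groupCohomology.iCocycles (Rep.trivial ℤ G ℤ) n)).1 inferInstance
  refine (map_sub (groupCohomology.iCocycles (Rep.trivial ℤ G ℤ) n).hom _ _).trans ?_
  erw [groupCohomology.iCocycles_mk, groupCohomology.iCocycles_mk, groupCohomology.iCocycles_mk]

/-! ## Cup and cap products, by the Alexander–Whitney formulas -/

/-- The first `p` entries of a tuple of length `p + q = n`. -/
def front {p q n : ℕ} (h : p + q = n) (g : Fin n → G) : Fin p → G := fun i => g ⟨i, by omega⟩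

/-- The last `q` entries of a tuple of length `p + q = n`. -/
def back {p q n : ℕ} (h : p + q = n) (g : Fin n → G) : Fin q → G := fun i => g ⟨p + i, by omega⟩

/-- `φ ∩ [g₁|…|gₙ] = φ(g₁,…,gₚ) [gₚ₊₁|…|gₙ]`, extended linearly. -/
def capChain {p q n : ℕ} (h : p + q = n) (φ : (Fin p → G) → ℤ) :
    ((Fin n → G) →₀ ℤ) →ₗ[ℤ] ((Fin q → G) →₀ ℤ) :=
  Finsupp.linearCombination ℤ fun g => single (back h g) (φ (front h g))

/-- `(φ ∪ ψ)(g₁,…,gₙ) = φ(g₁,…,gₚ) ψ(gₚ₊₁,…,gₙ)`. -/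
def cupCochain {p q n : ℕ} (h : p + q = n) (φ : (Fin p → G) → ℤ) (ψ : (Fin q → G) → ℤ) :
    (Fin n → G) → ℤ :=
  fun g => φ (front h g) * ψ (back h g)

lemma capChain_single {p q n : ℕ} (h : p + q = n) (φ : (Fin p → G) → ℤ) (g : Fin n → G) :
    capChain h φ (single g 1) = single (back h g) (φ (front h g)) := by
  simp [capChain]

lemma capChain_bd {p q n : ℕ} (h : p + (q + 1) = n + 1) (h' : p + q = n)
    (h'' : (p + 1) + q = n + 1) (φ : (Fin p → G) → ℤ) (z : (Fin (n + 1) → G) →₀ ℤ) :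
    capChain h' φ (bd n z) = (-1 : ℤ) ^ p • bd q (capChain h φ z) + capChain h'' (cobd p φ) z := by
  suffices H : capChain h' φ ∘ₗ bd n =
      (-1 : ℤ) ^ p • (bd q ∘ₗ capChain h φ) + capChain h'' (cobd p φ) from
    LinearMap.congr_fun H z
  refine Finsupp.lhom_ext' fun g => LinearMap.ext_ring ?_
  simp only [LinearMap.comp_apply, Finsupp.lsingle_apply, LinearMap.add_apply,
    LinearMap.smul_apply, capChain_single]
  rw [bd_single, ← mul_one (φ (front h g)), ← smul_eq_mul, ← Finsupp.smul_single, map_smul,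
    bd_single, cobd_apply]
  subst h'
  simp only [map_add, map_sum, map_smul, capChain_single]
  rw [← Equiv.sum_comp (finCongr (show p + (q + 1) = p + q + 1 by rfl)), Fin.sum_univ_add,
    Fin.sum_univ_castSucc (n := p)]
  have e1 : back rfl (fun i => g i.succ) = back h'' g := by
    funext i; simp only [back]; congr 1; ext; simp; omega
  have e2 : front rfl (fun i => g i.succ) = fun i => front h'' g i.succ := by
    funext i; simp only [front]; congr 1
  have e3 : (fun i => back h g i.succ) = back h'' g := by
    funext i; simp only [back]; congr 1; ext; simp; omega
  have e4 : Fin.contractNth (Fin.last p) (· * ·) (front h'' g) = front h g := by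
    funext i
    rw [Fin.contractNth_apply_of_lt _ _ _ _ i.isLt]; rfl
  have e5 (j : Fin p) : back rfl (Fin.contractNth (Fin.castAdd (q + 1) j) (· * ·) g)
      = back h'' g := by
    funext i
    simp only [back]
    rw [Fin.contractNth_apply_of_gt _ _ _ _ (by simp; omega)]
    congr 1; ext; simp; omega
  have e6 (j : Fin p) : front rfl (Fin.contractNth (Fin.castAdd (q + 1) j) (· * ·) g)
      = Fin.contractNth j.castSucc (· * ·) (front h'' g) := by
    funext i
    simp only [front, Fin.contractNth, Fin.val_castAdd, Fin.val_castSucc]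
    rfl
  have e7 (j : Fin (q + 1)) : back rfl (Fin.contractNth (Fin.natAdd p j) (· * ·) g)
      = Fin.contractNth j (· * ·) (back h g) := by
    funext i
    simp only [back, Fin.contractNth, Fin.val_natAdd, Fin.val_castSucc, add_lt_add_iff_left,
      add_right_inj]
    rfl
  have e8 (j : Fin (q + 1)) : front rfl (Fin.contractNth (Fin.natAdd p j) (· * ·) g)
      = front h g := by
    funext i
    simp only [front]
    rw [Fin.contractNth_apply_of_lt _ _ _ _ (by simp; omega)]
    rfl
  simp only [finCongr_refl, Equiv.refl_apply, e1, e2, e3, e4, e5, e6, e7, e8]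
  simp only [Finsupp.single_add, Finsupp.single_finsetSum, smul_add, Finset.smul_sum,
    Fin.val_castAdd, Fin.val_natAdd, Fin.val_castSucc, Fin.val_last, Finsupp.smul_single,
    smul_eq_mul, mul_one]
  have e9 (x : Fin (q + 1)) : (-1 : ℤ) ^ (p + (x : ℕ) + 1) * φ (front h g) =
      (-1) ^ p * (φ (front h g) * (-1) ^ ((x : ℕ) + 1)) := by ring
  have e10 : single (back h'' g) ((-1) ^ p * φ (front h g)) +
      single (back h'' g) ((-1) ^ (p + 1) * φ (front h g)) = 0 := by
    rw [← Finsupp.single_add, pow_succ]; simp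
  simp only [e9]
  rw [← sub_eq_zero]
  refine Eq.trans ?_ ((congrArg (fun t => -t) e10).trans neg_zero)
  abel

/-- Evaluation of a cochain on a chain. -/
def ev {n : ℕ} (ψ : (Fin n → G) → ℤ) : ((Fin n → G) →₀ ℤ) →ₗ[ℤ] ℤ :=
  Finsupp.linearCombination ℤ ψ

lemma ev_single {n : ℕ} (ψ : (Fin n → G) → ℤ) (g : Fin n → G) : ev ψ (single g 1) = ψ g := by
  simp [ev]

lemma ev_cobd {n : ℕ} (ψ : (Fin n → G) → ℤ) (z : (Fin (n + 1) → G) →₀ ℤ) :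
    ev (cobd n ψ) z = ev ψ (bd n z) := by
  suffices H : ev (cobd n ψ) = ev ψ ∘ₗ bd n from LinearMap.congr_fun H z
  refine Finsupp.lhom_ext' fun g => LinearMap.ext_ring ?_
  simp only [LinearMap.comp_apply, Finsupp.lsingle_apply, ev_single]
  rw [bd_single, cobd_apply]
  simp only [map_add, map_sum, map_smul, ev_single]

lemma ev_cupCochain {p q n : ℕ} (h : p + q = n) (φ : (Fin p → G) → ℤ) (ψ : (Fin q → G) → ℤ)
    (z : (Fin n → G) →₀ ℤ) : ev (cupCochain h φ ψ) z = ev ψ (capChain h φ z) := by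
  suffices H : ev (cupCochain h φ ψ) = ev ψ ∘ₗ capChain h φ from LinearMap.congr_fun H z
  refine Finsupp.lhom_ext' fun g => LinearMap.ext_ring ?_
  simp only [LinearMap.comp_apply, Finsupp.lsingle_apply, ev_single, capChain_single]
  simp [ev, cupCochain]

lemma cobd_cupCochain {p q n : ℕ} (h : p + q = n) (h' : p + (q + 1) = n + 1)
    (h'' : (p + 1) + q = n + 1) (φ : (Fin p → G) → ℤ) (ψ : (Fin q → G) → ℤ) :
    cobd n (cupCochain h φ ψ) =
      (-1 : ℤ) ^ p • cupCochain h' φ (cobd q ψ) + cupCochain h'' (cobd p φ) ψ := by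
  funext g
  simp only [Pi.add_apply, Pi.smul_apply]
  rw [← ev_single (cobd n _) g, ← ev_single (cupCochain h' φ _) g,
    ← ev_single (cupCochain h'' _ ψ) g, ev_cobd, ev_cupCochain, ev_cupCochain, ev_cupCochain,
    capChain_bd h' h h'', map_add, map_smul, ev_cobd]

lemma cobd_cupCochain_eq_zero {p q n : ℕ} (h : p + q = n) {φ : (Fin p → G) → ℤ}
    {ψ : (Fin q → G) → ℤ} (hφ : cobd p φ = 0) (hψ : cobd q ψ = 0) :
    cobd n (cupCochain h φ ψ) = 0 := by
  rw [cobd_cupCochain h (by omega) (by omega), hφ, hψ]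
  funext g
  simp [cupCochain]

lemma isCycle_capChain {p q n : ℕ} (h : p + q = n) {φ : (Fin p → G) → ℤ}
    {z : (Fin n → G) →₀ ℤ} (hφ : cobd p φ = 0) (hz : IsCycle n z) :
    IsCycle q (capChain h φ z) := by
  cases q with
  | zero => trivial
  | succ q =>
    cases n with
    | zero => omega
    | succ n =>
      have := capChain_bd h (by omega) (by omega) φ z
      rw [show bd n z = 0 from hz, hφ, map_zero] at this
      have h0 : capChain (p := p + 1) (q := q) (n := n + 1) (by omega) (0 : (Fin (p + 1) → G) → ℤ) z
          = 0 := by simp [capChain, Finsupp.linearCombination_apply]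
      rw [h0, add_zero] at this
      have h2 : ((-1 : ℤ) ^ p * (-1) ^ p) = 1 := by rw [← mul_pow]; simp
      have h1 := congrArg (fun t => (-1 : ℤ) ^ p • t) this
      simp only [smul_zero, smul_smul, h2, one_smul] at h1
      exact h1.symm

/-- The cup product `Hᵖ(G) × H^q(G) → H^{p+q}(G)`: apply `cupCochain` to representatives. By
`cup_cocls` the choice of the representatives is irrelevant. -/
def cup {p q n : ℕ} (h : p + q = n) (x : coH p G) (y : coH q G) : coH n G :=
  cocls n (cupCochain h (exists_cocls x).choose (exists_cocls y).choose)
    (cobd_cupCochain_eq_zero h (exists_cocls x).choose_spec.choose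
      (exists_cocls y).choose_spec.choose)

/-- The cap product `Hᵖ(G) × H_{p+q}(G) → H_q(G)`: apply `capChain` to representatives. By
`cap_cls` the choice of the representatives is irrelevant. -/
def cap {p q n : ℕ} (h : p + q = n) (x : coH p G) (z : H n G) : H q G :=
  cls q (capChain h (exists_cocls x).choose (exists_cls z).choose)
    (isCycle_capChain h (exists_cocls x).choose_spec.choose (exists_cls z).choose_spec.choose)

lemma IsCoboundary.add {n : ℕ} {φ φ' : (Fin n → G) → ℤ} (h : IsCoboundary n φ)
    (h' : IsCoboundary n φ') : IsCoboundary n (φ + φ') := by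
  cases n with
  | zero => exact (congrArg₂ _ h h').trans (add_zero 0)
  | succ n =>
    obtain ⟨χ, rfl⟩ := h
    obtain ⟨χ', rfl⟩ := h'
    exact ⟨χ + χ', map_add _ _ _⟩

lemma isCoboundary_cupCochain_left {p q n : ℕ} (h : p + q = n) {φ : (Fin p → G) → ℤ}
    {ψ : (Fin q → G) → ℤ} (hφ : IsCoboundary p φ) (hψ : cobd q ψ = 0) :
    IsCoboundary n (cupCochain h φ ψ) := by
  cases p with
  | zero =>
    obtain rfl : φ = 0 := hφ
    have : cupCochain h 0 ψ = 0 := by funext g; simp [cupCochain]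
    rw [this]
    cases n with
    | zero => rfl
    | succ n => exact ⟨0, map_zero _⟩
  | succ p =>
    obtain ⟨χ, rfl⟩ := hφ
    obtain ⟨n, rfl⟩ : ∃ m, n = m + 1 := ⟨p + q, by omega⟩
    refine ⟨cupCochain (by omega) χ ψ, ?_⟩
    rw [cobd_cupCochain (by omega) (by omega) h, hψ]
    funext g
    simp [cupCochain]

lemma isCoboundary_cupCochain_right {p q n : ℕ} (h : p + q = n) {φ : (Fin p → G) → ℤ}
    {ψ : (Fin q → G) → ℤ} (hφ : cobd p φ = 0) (hψ : IsCoboundary q ψ) :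
    IsCoboundary n (cupCochain h φ ψ) := by
  cases q with
  | zero =>
    obtain rfl : ψ = 0 := hψ
    have : cupCochain h φ 0 = 0 := by funext g; simp [cupCochain]
    rw [this]
    cases n with
    | zero => rfl
    | succ n => exact ⟨0, map_zero _⟩
  | succ q =>
    obtain ⟨χ, rfl⟩ := hψ
    obtain ⟨n, rfl⟩ : ∃ m, n = m + 1 := ⟨p + q, by omega⟩
    refine ⟨(-1 : ℤ) ^ p • cupCochain (by omega) φ χ, ?_⟩
    rw [map_smul, cobd_cupCochain (by omega) h (by omega), hφ]
    have h2 : ((-1 : ℤ) ^ p * (-1) ^ p) = 1 := by rw [← mul_pow]; simp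
    rw [smul_add, smul_smul, h2, one_smul]
    funext g
    simp [cupCochain]

lemma cocls_cupCochain_congr {p q n : ℕ} (h : p + q = n) {φ φ' : (Fin p → G) → ℤ}
    {ψ ψ' : (Fin q → G) → ℤ} (hφ' : cobd p φ' = 0) (hφ : cobd p φ = 0) (hψ' : cobd q ψ' = 0)
    (hψ : cobd q ψ = 0) (eφ : cocls p φ' hφ' = cocls p φ hφ)
    (eψ : cocls q ψ' hψ' = cocls q ψ hψ) :
    cocls n (cupCochain h φ' ψ') (cobd_cupCochain_eq_zero h hφ' hψ') =
      cocls n (cupCochain h φ ψ) (cobd_cupCochain_eq_zero h hφ hψ) := by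
  rw [cocls_eq_iff] at eφ eψ ⊢
  have : cupCochain h φ' ψ' - cupCochain h φ ψ =
      cupCochain h (φ' - φ) ψ' + cupCochain h φ (ψ' - ψ) := by
    funext g; simp [cupCochain]; ring
  rw [this]
  exact (isCoboundary_cupCochain_left h eφ hψ').add (isCoboundary_cupCochain_right h hφ eψ)

/-- `[φ] ∪ [ψ] = [φ ∪ ψ]`. -/
theorem cup_cocls {p q n : ℕ} (h : p + q = n) {φ : (Fin p → G) → ℤ} {ψ : (Fin q → G) → ℤ}
    (hφ : cobd p φ = 0) (hψ : cobd q ψ = 0) :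
    cup h (cocls p φ hφ) (cocls q ψ hψ) =
      cocls n (cupCochain h φ ψ) (cobd_cupCochain_eq_zero h hφ hψ) :=
  cocls_cupCochain_congr h _ hφ _ hψ (exists_cocls (cocls p φ hφ)).choose_spec.choose_spec
    (exists_cocls (cocls q ψ hψ)).choose_spec.choose_spec

lemma cls_capChain_congr {p q n : ℕ} (h : p + q = n) {φ φ' : (Fin p → G) → ℤ}
    {z z' : (Fin n → G) →₀ ℤ} (hφ' : cobd p φ' = 0) (hφ : cobd p φ = 0) (hz' : IsCycle n z')
    (hz : IsCycle n z) (eφ : cocls p φ' hφ' = cocls p φ hφ) (ez : cls n z' hz' = cls n z hz) :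
    cls q (capChain h φ' z') (isCycle_capChain h hφ' hz') =
      cls q (capChain h φ z) (isCycle_capChain h hφ hz) := by
  rw [cocls_eq_iff] at eφ
  rw [cls_eq_iff] at ez ⊢
  have zero_cap {r s m : ℕ} (h : r + s = m) (w : (Fin m → G) →₀ ℤ) : capChain h 0 w = 0 := by
    simp [capChain, Finsupp.linearCombination_apply]
  have h2 : ((-1 : ℤ) ^ p * (-1) ^ p) = 1 := by rw [← mul_pow]; simp
  have e : capChain h φ' z' - capChain h φ z =
      capChain h (φ' - φ) z' + capChain h φ (z' - z) := by
    have : capChain h (φ' - φ) z' = capChain h φ' z' - capChain h φ z' := by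
      simp [capChain, Finsupp.linearCombination_apply, Finsupp.single_sub, smul_sub,
        Finsupp.sum_sub]
    rw [this, map_sub]; abel
  obtain ⟨w, hw⟩ := ez
  have r1 : ∃ w', bd q w' = capChain h φ (z' - z) := by
    refine ⟨(-1 : ℤ) ^ p • capChain (by omega) φ w, ?_⟩
    rw [← hw, capChain_bd (by omega) h (by omega), hφ, zero_cap, map_smul, add_zero]
  have r2 : ∃ w', bd q w' = capChain h (φ' - φ) z' := by
    cases p with
    | zero =>
      rw [show φ' - φ = 0 from eφ, zero_cap]
      exact ⟨0, map_zero _⟩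
    | succ p =>
      obtain ⟨χ, hχ⟩ := eφ
      obtain ⟨n, rfl⟩ : ∃ m, n = m + 1 := ⟨p + q, by omega⟩
      have := capChain_bd (by omega) (by omega) h χ z'
      rw [show bd n z' = 0 from hz', map_zero, hχ] at this
      refine ⟨-((-1 : ℤ) ^ p • capChain (by omega) χ z'), ?_⟩
      rw [map_neg, map_smul]
      exact neg_eq_of_add_eq_zero_right this.symm
  obtain ⟨w₁, h₁⟩ := r1
  obtain ⟨w₂, h₂⟩ := r2
  exact ⟨w₂ + w₁, by rw [map_add, h₁, h₂, e]⟩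

/-- `[φ] ∩ [z] = [φ ∩ z]`. -/
theorem cap_cls {p q n : ℕ} (h : p + q = n) {φ : (Fin p → G) → ℤ} {z : (Fin n → G) →₀ ℤ}
    (hφ : cobd p φ = 0) (hz : IsCycle n z) :
    cap h (cocls p φ hφ) (cls n z hz) = cls q (capChain h φ z) (isCycle_capChain h hφ hz) :=
  cls_capChain_congr h _ hφ _ hz (exists_cocls (cocls p φ hφ)).choose_spec.choose_spec
    (exists_cls (cls n z hz)).choose_spec.choose_spec

/-- The class in `H¹(G) = Hom(G, ℤ)` of a homomorphism. -/
def homClass (f : Additive G →+ ℤ) : coH 1 G :=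
  cocls 1 (fun g => f (Additive.ofMul (g 0))) (by
    funext g
    rw [cobd_apply]
    simp [Fin.sum_univ_two, Fin.contractNth])

end

/-! ## The fundamental class -/

section

variable {G : Type} [CommGroup G]

/-- The Pontryagin product `γ₁ · … · γₙ` of `1`-chains of a commutative group, i.e. the shuffle
product `∑_σ sgn(σ) [γ_{σ(1)}|…|γ_{σ(n)}]`. -/
def pontryaginChain {n : ℕ} (γ : Fin n → G) : (Fin n → G) →₀ ℤ :=
  ∑ σ : Equiv.Perm (Fin n), single (γ ∘ σ) (Equiv.Perm.sign σ : ℤ)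

lemma isCycle_pontryaginChain {n : ℕ} (γ : Fin n → G) : IsCycle n (pontryaginChain γ) := by
  cases n with
  | zero => trivial
  | succ n =>
    show bd n (pontryaginChain γ) = 0
    have e (σ : Equiv.Perm (Fin (n + 1))) : single (γ ∘ σ) (Equiv.Perm.sign σ : ℤ) =
        (Equiv.Perm.sign σ : ℤ) • single (γ ∘ σ) (1 : ℤ) := by simp
    simp only [pontryaginChain, e, map_sum, map_smul]
    simp only [bd_single, smul_add, Finset.sum_add_distrib, Finset.smul_sum]
    rw [Finset.sum_comm, Fin.sum_univ_castSucc]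
    have hmid (j : Fin n) : ∑ σ : Equiv.Perm (Fin (n + 1)), (Equiv.Perm.sign σ : ℤ) •
        (-1 : ℤ) ^ ((j.castSucc : ℕ) + 1) •
          single (Fin.contractNth j.castSucc (· * ·) (γ ∘ σ)) (1 : ℤ) = 0 := by
      refine Finset.sum_involution (fun σ _ => σ * Equiv.swap j.castSucc j.succ) ?_ ?_ ?_ ?_
      · intro σ _
        have : Fin.contractNth j.castSucc (· * ·) (γ ∘ ⇑(σ * Equiv.swap j.castSucc j.succ)) =
            Fin.contractNth j.castSucc (· * ·) (γ ∘ σ) := by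
          funext k
          rcases lt_trichotomy (k : ℕ) j with hk | hk | hk
          · rw [Fin.contractNth_apply_of_lt _ _ _ _ hk, Fin.contractNth_apply_of_lt _ _ _ _ hk]
            simp only [Function.comp_apply, Equiv.Perm.mul_apply]
            rw [Equiv.swap_apply_of_ne_of_ne] <;> simp [Fin.ext_iff] <;> omega
          · obtain rfl : k = j := Fin.ext hk
            rw [Fin.contractNth_apply_of_eq _ _ _ _ rfl, Fin.contractNth_apply_of_eq _ _ _ _ rfl]
            simp [mul_comm]
          · rw [Fin.contractNth_apply_of_gt _ _ _ _ hk, Fin.contractNth_apply_of_gt _ _ _ _ hk]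
            simp only [Function.comp_apply, Equiv.Perm.mul_apply]
            rw [Equiv.swap_apply_of_ne_of_ne] <;> simp [Fin.ext_iff] <;> omega
        rw [this, Equiv.Perm.sign_mul, Equiv.Perm.sign_swap (by simp [Fin.ext_iff])]
        simp
      · intro σ _ _ h
        have := congrArg (fun τ => σ⁻¹ * τ) h
        simp [Equiv.swap_eq_one_iff, Fin.ext_iff] at this
      · intro _ _; exact Finset.mem_univ _
      · intro σ _; simp [mul_assoc]
    rw [Finset.sum_eq_zero fun j _ => hmid j, zero_add]
    rw [← Equiv.sum_comp (Equiv.mulRight (finRotate (n + 1)))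
      (fun σ : Equiv.Perm (Fin (n + 1)) => (Equiv.Perm.sign σ : ℤ) •
        (-1 : ℤ) ^ (((Fin.last n : Fin (n + 1)) : ℕ) + 1) •
          single (Fin.contractNth (Fin.last n) (· * ·) (γ ∘ σ)) (1 : ℤ)),
      ← Finset.sum_add_distrib]
    refine Finset.sum_eq_zero fun σ _ => ?_
    have : Fin.contractNth (Fin.last n) (· * ·) (γ ∘ (Equiv.mulRight (finRotate (n + 1)) σ)) =
        fun i => (γ ∘ σ) i.succ := by
      funext k
      rw [Fin.contractNth_apply_of_lt _ _ _ _ k.isLt]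
      simp
    rw [this]
    have h2 : ((-1 : ℤ) ^ n * (-1) ^ n) = 1 := by rw [← mul_pow]; simp
    simp [sign_finRotate, pow_succ, mul_assoc, h2]

/-- The Pontryagin product `γ₁ · … · γₙ ∈ Hₙ(G)`. -/
def pontryagin {n : ℕ} (γ : Fin n → G) : H n G :=
  cls n (pontryaginChain γ) (isCycle_pontryaginChain γ)

end

/-! ## Free abelian groups -/

/-- The group `ℤⁿ`, written multiplicatively. -/
abbrev Zn (n : ℕ) : Type := Multiplicative (Fin n → ℤ)

/-- The class `xᵢ ∈ H¹(ℤⁿ) = Hom(ℤⁿ, ℤ)` of the dual basis of a basis `γ`. -/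
def dualClass {n : ℕ} (γ : Module.Basis (Fin n) ℤ (Fin n → ℤ)) (i : Fin n) : coH 1 (Zn n) :=
  homClass ((γ.coord i).toAddMonoidHom.comp
    (AddEquiv.additiveMultiplicative (Fin n → ℤ)).toAddMonoidHom)

/-- The orientation class `[T] ∈ Hₙ(ℤⁿ)` of the `n`-torus determined by the basis `γ`: the product
of the classes of its `n` coordinate circles. -/
def fundamentalClass {n : ℕ} (γ : Module.Basis (Fin n) ℤ (Fin n → ℤ)) : H n (Zn n) :=
  pontryagin fun i => Multiplicative.ofAdd (γ i)

/-- The map `A_* : H_k(ℤⁿ) → H_k(ℤⁿ)` induced by an automorphism `A` of `ℤⁿ`. -/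
def autMap {n : ℕ} (A : (Fin n → ℤ) ≃+ (Fin n → ℤ)) (k : ℕ) : H k (Zn n) →ₗ[ℤ] H k (Zn n) :=
  pushforward (AddMonoidHom.toMultiplicative A.toAddMonoidHom) k

end TorusHomology

end

open TorusHomology

noncomputable section
namespace TorusHomology
open CategoryTheory Finsupp

/-! ## Numbers of generators -/

/-! By Poincaré duality, every class in `H 4 (Zn 6)` is `(∑ Uᵢⱼ xᵢxⱼ) ∩ [T]` for an integer matrix
`U`, and it determines exactly the alternating matrix `W = U - Uᵀ`. An automorphism whose inverse
has matrix `P` acts by `W ↦ det P · PᵀWP` (`autMap_quadClass`), the factor `det P` being the effect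
on the orientation class. The theorem thus classifies alternating forms on `ℤ⁶` up to this twisted
congruence.

Existence is the elementary divisor theorem for alternating forms (`exists_basis_of_isAlt`),
followed by sign changes of basis vectors. These make `a` and `b` nonnegative and `det P = 1`, which
uses up the freedom in the sign of `c`. For uniqueness, `a` divides every value of the form, `a * b`
divides every `4 × 4` Pfaffian, and `a * b * c` is the full Pfaffian. The twist multiplies the
latter by `(det P)³ · det P = 1`, so even its sign is invariant (`dvd_of_normalMatrix_eq`).

Duality is obtained by counting. Products of four degree-one classes are evaluated on `H 4 (Zn 6)`;
on a class given by `U` the value is `∑ Uᵢⱼ det(eᵢ, eⱼ, F)`, and suitable `F` isolate each `±(Uᵢⱼ -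
Uⱼᵢ)`. This yields a surjection from `H 4 (Zn 6)` onto `ℤ¹⁵`. Since `H 4 (Zn 6)` is generated by `15
= 6.choose 4` elements (`generatedBy_H`) and a surjective endomorphism of `ℤ¹⁵` is injective, it is
an isomorphism (`exists_jointly_injective`).

The bound on generators comes from dimension shifting along `0 → ℤ[X × ℤ] → ℤ[X × ℤ] → ℤ[X] → 0`:
one factor `ℤ` at a time is moved into the permuted set until the action is free and transitive, and
Pascal's rule counts the generators. -/

/-- The abelian group `M` is generated by `k` elements. -/
def GeneratedBy (M : Type*) [AddCommGroup M] (k : ℕ) : Prop :=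
  ∃ f : (Fin k → ℤ) →+ M, Function.Surjective f

lemma GeneratedBy.of_surjective {M N : Type*} [AddCommGroup M] [AddCommGroup N]
    {k : ℕ} (h : GeneratedBy M k) (g : M →+ N) (hg : Function.Surjective g) :
    GeneratedBy N k := by
  obtain ⟨f, hf⟩ := h
  exact ⟨g.comp f, hg.comp hf⟩

lemma GeneratedBy.mono {M : Type*} [AddCommGroup M] {k l : ℕ}
    (h : GeneratedBy M k) (hkl : k ≤ l) : GeneratedBy M l := by
  obtain ⟨f, hf⟩ := h
  refine ⟨f.comp (LinearMap.funLeft ℤ ℤ (Fin.castLE hkl)).toAddMonoidHom, hf.comp ?_⟩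
  exact LinearMap.funLeft_surjective_of_injective ℤ ℤ _ (Fin.castLE_injective hkl)

/-- The preimage in `ℤᵏ` is a subgroup of a free abelian group of rank `k`, hence free of rank at
most `k`. -/
lemma GeneratedBy.addSubgroup {M : Type*} [AddCommGroup M] {k : ℕ}
    (h : GeneratedBy M k) (S : AddSubgroup M) : GeneratedBy S k := by
  obtain ⟨f, hf⟩ := h
  let T : Submodule ℤ (Fin k → ℤ) := AddSubgroup.toIntSubmodule (S.comap f)
  have hle : Module.finrank ℤ T ≤ k := by
    simpa using Submodule.finrank_le T
  refine GeneratedBy.mono ?_ hle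
  let b := Module.finBasis ℤ T
  let g : T →+ S := (f.comp T.subtype.toAddMonoidHom).codRestrict S fun x => x.2
  refine ⟨g.comp b.equivFun.symm.toAddEquiv.toAddMonoidHom,
    Function.Surjective.comp (g := g) ?_ b.equivFun.symm.surjective⟩
  rintro ⟨y, hy⟩
  obtain ⟨x, rfl⟩ := hf y
  exact ⟨⟨x, hy⟩, rfl⟩

/-- Images of generators of `A`, together with lifts of generators of the subgroup `g.range` of `C`,
generate `B`. -/
lemma GeneratedBy.of_exact {A B C : Type*} [AddCommGroup A] [AddCommGroup B] [AddCommGroup C]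
    {k l : ℕ} (f : A →+ B) (g : B →+ C)
    (hfg : ∀ b, g b = 0 → ∃ a, f a = b) (hA : GeneratedBy A k) (hC : GeneratedBy C l) :
    GeneratedBy B (k + l) := by
  obtain ⟨s, hs⟩ := hA
  obtain ⟨r, hr⟩ := hC.addSubgroup g.range
  have hlift (i : Fin l) : ∃ b, g b = (r (Pi.single i 1) : C) := (r (Pi.single i 1)).2
  choose b hb using hlift
  let t : (Fin l → ℤ) →+ B := (Fintype.linearCombination ℤ b).toAddMonoidHom
  have ht : ∀ x, g (t x) = r x := by
    have : g.comp t = g.range.subtype.comp r := by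
      refine AddMonoidHom.functions_ext _ _ _ fun i n => ?_
      have e : (Pi.single i n : Fin l → ℤ) = n • Pi.single i 1 := by
        rw [← Pi.single_smul]; simp
      rw [e, map_zsmul, map_zsmul]
      congr 1
      simp [t, Fintype.linearCombination_apply_single, hb]
    exact fun x => DFunLike.congr_fun this x
  let p₁ : (Fin (k + l) → ℤ) →+ (Fin k → ℤ) := (LinearMap.funLeft ℤ ℤ (Fin.castAdd l)).toAddMonoidHom
  let p₂ : (Fin (k + l) → ℤ) →+ (Fin l → ℤ) := (LinearMap.funLeft ℤ ℤ (Fin.natAdd k)).toAddMonoidHom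
  refine ⟨f.comp (s.comp p₁) + t.comp p₂, fun y => ?_⟩
  obtain ⟨x, hx⟩ := hr ⟨g y, y, rfl⟩
  obtain ⟨a, ha⟩ := hfg (y - t x) (by rw [map_sub, ht, hx, sub_self])
  obtain ⟨w, rfl⟩ := hs a
  refine ⟨Fin.append w x, ?_⟩
  have e1 : p₁ (Fin.append w x) = w := by
    funext i; simp [p₁, LinearMap.funLeft_apply]
  have e2 : p₂ (Fin.append w x) = x := by
    funext i; simp [p₂, LinearMap.funLeft_apply]
  rw [AddMonoidHom.add_apply, AddMonoidHom.comp_apply, AddMonoidHom.comp_apply,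
    AddMonoidHom.comp_apply, e1, e2, ha,
    sub_add_cancel]

/-! ## Permutation modules -/

section

variable {Γ : Type} [Group Γ]

lemma rep_exact {k G : Type} [CommRing k] [Group G] {S : ShortComplex (Rep.{0} k G)}
    (h : ∀ x : S.X₂, S.g.hom x = 0 → ∃ w : S.X₁, S.f.hom w = x) : S.Exact := by
  rw [← ShortComplex.exact_map_iff_of_faithful _ (forget₂ (Rep.{0} k G) (ModuleCat.{0} k)),
    ShortComplex.moduleCat_exact_iff]
  exact h

/-- The permutation representation `ℤ[X]` of an action of `Γ` on `X`. -/
def permRepresentation {X : Type} (φ : Γ →* Equiv.Perm X) : Representation ℤ Γ (X →₀ ℤ) where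
  toFun g := Finsupp.lmapDomain ℤ ℤ (φ g)
  map_one' := by ext; simp
  map_mul' g h := by ext; simp

lemma permRepresentation_single {X : Type} (φ : Γ →* Equiv.Perm X) (g : Γ) (x : X) (n : ℤ) :
    permRepresentation φ g (single x n) = single (φ g x) n :=
  Finsupp.mapDomain_single

/-- The permutation module `ℤ[X]` of an action of `Γ` on `X`. -/
abbrev permRep {X : Type} (φ : Γ →* Equiv.Perm X) : Rep.{0} ℤ Γ :=
  Rep.of (permRepresentation φ)

/-- The map of permutation modules induced by an equivariant map. -/
def permRepMap {X Y : Type} {φ : Γ →* Equiv.Perm X} {ψ : Γ →* Equiv.Perm Y} (f : X → Y)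
    (hf : ∀ g x, f (φ g x) = ψ g (f x)) :
    (permRepresentation φ).IntertwiningMap (permRepresentation ψ) where
  toLinearMap := Finsupp.lmapDomain ℤ ℤ f
  isIntertwining' g := by
    refine Finsupp.lhom_ext' fun x => LinearMap.ext_ring ?_
    simp [permRepresentation_single, hf]

/-- The action of `Γ` on `X × ℤ` given by an action on `X` and a homomorphism to `ℤ`. -/
def prodIntPerm {X : Type} (φ : Γ →* Equiv.Perm X) (ψ : Γ →* Multiplicative ℤ) :
    Γ →* Equiv.Perm (X × ℤ) where
  toFun g := Equiv.prodCongr (φ g) (Equiv.addLeft (ψ g).toAdd)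
  map_one' := by ext <;> simp
  map_mul' g h := by ext <;> simp [add_assoc]

lemma prodIntPerm_apply {X : Type} (φ : Γ →* Equiv.Perm X) (ψ : Γ →* Multiplicative ℤ) (g : Γ)
    (x : X × ℤ) : prodIntPerm φ ψ g x = (φ g x.1, (ψ g).toAdd + x.2) := rfl

/-- The map `ℤ[X × ℤ] → ℤ[X]` induced by the projection. -/
def projMap {X : Type} (φ : Γ →* Equiv.Perm X) (ψ : Γ →* Multiplicative ℤ) :
    (permRepresentation (prodIntPerm φ ψ)).IntertwiningMap (permRepresentation φ) :=
  permRepMap Prod.fst fun _ _ => rfl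

/-- The map `t - 1` on `ℤ[X × ℤ]`, where `t` is the translation by `1`. -/
def shiftSubMap {X : Type} (φ : Γ →* Equiv.Perm X) (ψ : Γ →* Multiplicative ℤ) :
    (permRepresentation (prodIntPerm φ ψ)).IntertwiningMap
      (permRepresentation (prodIntPerm φ ψ)) :=
  permRepMap (fun x => (x.1, x.2 + 1)) (fun g x => by simp [prodIntPerm_apply, add_assoc]) -
    Representation.IntertwiningMap.id _

variable {X : Type} (φ : Γ →* Equiv.Perm X) (ψ : Γ →* Multiplicative ℤ)

lemma projMap_single (x : X × ℤ) (n : ℤ) : projMap φ ψ (single x n) = single x.1 n :=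
  Finsupp.mapDomain_single

lemma shiftSubMap_single (x : X × ℤ) (n : ℤ) :
    shiftSubMap φ ψ (single x n) = single (x.1, x.2 + 1) n - single x n := by
  exact congrArg (· - single x n) Finsupp.mapDomain_single

lemma shiftSubMap_apply (f : X × ℤ →₀ ℤ) (x : X) (n : ℤ) :
    shiftSubMap φ ψ f (x, n) = f (x, n - 1) - f (x, n) := by
  have hinj : Function.Injective (fun x : X × ℤ => (x.1, x.2 + 1)) := by
    rintro ⟨a, b⟩ ⟨c, d⟩ h
    simpa using h
  have e := Finsupp.mapDomain_apply hinj f (x, n - 1)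
  rw [sub_add_cancel] at e
  exact congrArg (· - f (x, n)) e

/-- An element of the kernel is invariant under translation of the `ℤ`-coordinate, which is
incompatible with finite support unless it vanishes. -/
lemma shiftSubMap_injective : Function.Injective (shiftSubMap φ ψ) := by
  refine (injective_iff_map_eq_zero (shiftSubMap φ ψ)).2 fun f hf => ?_
  have h1 (x : X) (n : ℤ) : f (x, n - 1) = f (x, n) := by
    have := DFunLike.congr_fun hf (x, n)
    rw [shiftSubMap_apply] at this
    exact sub_eq_zero.1 this
  have h2 (x : X) (n : ℤ) : f (x, n) = f (x, 0) := by
    induction n using Int.induction_on with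
    | zero => rfl
    | succ i ih => rw [← ih, ← h1 x (i + 1), add_sub_cancel_right]
    | pred i ih => rw [← ih, h1]
  ext ⟨x, n⟩
  rw [h2]
  by_contra hne
  have : (Set.range fun n : ℤ => (x, n)) ⊆ (f.support : Set (X × ℤ)) := by
    rintro _ ⟨m, rfl⟩
    simpa [h2 x m] using hne
  exact Set.infinite_range_of_injective (fun a b h => by simpa using h)
    (f.support.finite_toSet.subset this)

lemma projMap_shiftSubMap (f : X × ℤ →₀ ℤ) : projMap φ ψ (shiftSubMap φ ψ f) = 0 := by
  induction f using Finsupp.induction_linear with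
  | zero => simp
  | add f g hf hg => simp [hf, hg]
  | single x n => rw [shiftSubMap_single, map_sub, projMap_single, projMap_single, sub_self]

lemma single_sub_single_mem_range (x : X) (n c : ℤ) :
    ∃ w, shiftSubMap φ ψ w = single (x, n) c - single (x, 0) c := by
  induction n using Int.induction_on with
  | zero => exact ⟨0, by simp⟩
  | succ i ih =>
    obtain ⟨w, hw⟩ := ih
    exact ⟨single (x, (i : ℤ)) c + w, by rw [map_add, hw, shiftSubMap_single]; abel⟩
  | pred i ih =>
    obtain ⟨w, hw⟩ := ih
    exact ⟨w - single (x, -(i : ℤ) - 1) c, by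
      rw [map_sub, hw, shiftSubMap_single, sub_add_cancel]; abel⟩

/-- Modulo the image of `t - 1` every `(x, n)` may be moved to `(x, 0)`. On the kernel of the
projection the subtracted term is zero, which gives exactness in the middle. -/
lemma exists_shiftSubMap_eq (f : X × ℤ →₀ ℤ) :
    ∃ w, shiftSubMap φ ψ w = f - (projMap φ ψ f).mapDomain (fun x => (x, 0)) := by
  induction f using Finsupp.induction_linear with
  | zero => exact ⟨0, by simp⟩
  | add f g hf hg =>
    obtain ⟨v, hv⟩ := hf
    obtain ⟨w, hw⟩ := hg
    exact ⟨v + w, by rw [map_add, hv, hw, map_add, Finsupp.mapDomain_add]; abel⟩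
  | single x n =>
    rw [projMap_single, Finsupp.mapDomain_single]
    exact single_sub_single_mem_range φ ψ x.1 x.2 n

lemma projMap_surjective : Function.Surjective (projMap φ ψ) := by
  intro f
  refine ⟨f.mapDomain (fun x => (x, 0)), ?_⟩
  show Finsupp.mapDomain Prod.fst _ = _
  rw [← Finsupp.mapDomain_comp]
  exact Finsupp.mapDomain_id

/-- The sequence `0 → ℤ[X × ℤ] → ℤ[X × ℤ] → ℤ[X] → 0`. -/
def permShortComplex : ShortComplex (Rep.{0} ℤ Γ) :=
  ShortComplex.mk (Rep.ofHom (shiftSubMap φ ψ)) (Rep.ofHom (projMap φ ψ)) (by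
    refine Rep.hom_ext (DFunLike.ext _ _ fun f => ?_)
    exact projMap_shiftSubMap φ ψ f)

lemma permShortComplex_shortExact : (permShortComplex φ ψ).ShortExact where
  exact := by
    refine rep_exact fun f hf => ?_
    obtain ⟨w, hw⟩ := exists_shiftSubMap_eq φ ψ f
    have hf' : projMap φ ψ f = 0 := hf
    refine ⟨w, ?_⟩
    rw [hf', Finsupp.mapDomain_zero] at hw
    exact hw.trans (sub_zero (G := X × ℤ →₀ ℤ) f)
  mono_f := (Rep.mono_iff_injective _).2 (shiftSubMap_injective φ ψ)
  epi_g := (Rep.epi_iff_surjective _).2 (projMap_surjective φ ψ)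

lemma generatedBy_groupHomology_zero {k : ℕ}
    (h : GeneratedBy (groupHomology (permRep (prodIntPerm φ ψ)) 0) k) :
    GeneratedBy (groupHomology (permRep φ) 0) k := by
  have := (permShortComplex_shortExact φ ψ).epi_g
  have : Epi ((groupHomology.functor ℤ Γ 0).map (permShortComplex φ ψ).g) :=
    groupHomology.epi_map_0_of_epi _
  exact h.of_surjective (ModuleCat.Hom.hom _).toAddMonoidHom ((ModuleCat.epi_iff_surjective _).1 this)

/-- In the long exact sequence, the homology of `ℤ[X]` in degree `n + 1` sits between that of `ℤ[X ×
ℤ]` in degrees `n + 1` and `n`. -/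
lemma generatedBy_groupHomology_succ {n k l : ℕ}
    (h : GeneratedBy (groupHomology (permRep (prodIntPerm φ ψ)) (n + 1)) k)
    (h' : GeneratedBy (groupHomology (permRep (prodIntPerm φ ψ)) n) l) :
    GeneratedBy (groupHomology (permRep φ) (n + 1)) (k + l) := by
  have hex := groupHomology.mapShortComplex₃_exact (permShortComplex_shortExact φ ψ)
    (rfl : n + 1 = n + 1)
  rw [ShortComplex.moduleCat_exact_iff] at hex
  exact GeneratedBy.of_exact (A := groupHomology (permRep (prodIntPerm φ ψ)) (n + 1))
    (C := groupHomology (permRep (prodIntPerm φ ψ)) n) 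
    (ModuleCat.Hom.hom (groupHomology.mapShortComplex₃ (permShortComplex_shortExact φ ψ)
      (rfl : n + 1 = n + 1)).f).toAddMonoidHom
    (ModuleCat.Hom.hom (groupHomology.mapShortComplex₃ (permShortComplex_shortExact φ ψ)
      (rfl : n + 1 = n + 1)).g).toAddMonoidHom hex h h'

end
-- Homology of free permutation modules, and the bound for `ℤᵐ`
section

variable {Γ : Type} [Group Γ] {X : Type}

/-- The contraction of the bar complex with coefficients in the free module `ℤ[X]` given by an
equivariant map `θ : X → Γ`. -/
def barContraction (θ : X → Γ) (x₀ : X) (n : ℕ) :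
    ((Fin n → Γ) →₀ (X →₀ ℤ)) →ₗ[ℤ] ((Fin (n + 1) → Γ) →₀ (X →₀ ℤ)) :=
  Finsupp.lsum ℤ fun g => Finsupp.lsum ℤ fun x =>
    Finsupp.lsingle (Fin.cons (θ x)⁻¹ g : Fin (n + 1) → Γ) ∘ₗ Finsupp.lsingle x₀

lemma barContraction_single (θ : X → Γ) (x₀ : X) (n : ℕ) (g : Fin n → Γ) (x : X) (c : ℤ) :
    barContraction θ x₀ n (single g (single x c)) =
      single (Fin.cons (θ x)⁻¹ g : Fin (n + 1) → Γ) (single x₀ c) := by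
  rw [barContraction, Finsupp.lsum_single, Finsupp.lsum_single]
  rfl

lemma contractNth_zero_cons {n : ℕ} (a : Γ) (g : Fin (n + 1) → Γ) :
    Fin.contractNth 0 (· * ·) (Fin.cons a g : Fin (n + 2) → Γ) =
      (Fin.cons (a * g 0) fun i => g i.succ : Fin (n + 1) → Γ) := by
  funext k
  refine Fin.cases ?_ (fun k => ?_) k
  · rw [Fin.contractNth_apply_of_eq _ _ _ _ (by simp)]
    simp
  · rw [Fin.contractNth_apply_of_gt _ _ _ _ (by simp)]
    simp

lemma contractNth_succ_cons {n : ℕ} (j : Fin (n + 1)) (a : Γ) (g : Fin (n + 1) → Γ) :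
    Fin.contractNth j.succ (· * ·) (Fin.cons a g : Fin (n + 2) → Γ) =
      (Fin.cons a (Fin.contractNth j (· * ·) g) : Fin (n + 1) → Γ) := by
  funext k
  refine Fin.cases ?_ (fun k => ?_) k
  · rw [Fin.contractNth_apply_of_lt _ _ _ _ (by simp)]
    simp
  · simp only [Fin.contractNth, Fin.val_succ, Fin.cons_succ, add_lt_add_iff_right,
      add_left_inj]
    rfl

variable (φ : Γ →* Equiv.Perm X)

/-- The first face of the new simplex carries `x₀` back to `x` and yields the identity. The
remaining faces cancel against the contraction of the boundary, since prepending an entry shifts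
indices and so reverses signs; equivariance of `θ` matches the face that multiplies `(θ x)⁻¹` into
`g 0`. -/
lemma d_barContraction {θ : X → Γ} {x₀ : X} (hθ : ∀ x, φ (θ x) x₀ = x)
    (hθ' : ∀ g x, θ (φ g x) = g * θ x) (n : ℕ) (z : (Fin (n + 1) → Γ) →₀ (X →₀ ℤ)) :
    (groupHomology.inhomogeneousChains.d (permRep φ) (n + 1)).hom (barContraction θ x₀ (n + 1) z) +
      barContraction θ x₀ n ((groupHomology.inhomogeneousChains.d (permRep φ) n).hom z) = z := by
  suffices h : (groupHomology.inhomogeneousChains.d (permRep φ) (n + 1)).hom ∘ₗ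
      barContraction θ x₀ (n + 1) +
      barContraction θ x₀ n ∘ₗ (groupHomology.inhomogeneousChains.d (permRep φ) n).hom =
        LinearMap.id from LinearMap.congr_fun h z
  refine Finsupp.lhom_ext' fun g => Finsupp.lhom_ext' fun x => LinearMap.ext_ring ?_
  simp only [LinearMap.comp_apply, LinearMap.add_apply, Finsupp.lsingle_apply, LinearMap.id_apply]
  rw [barContraction_single]
  have h1 := groupHomology.inhomogeneousChains.d_single (A := permRep φ) (n + 1)
    (Fin.cons (θ x)⁻¹ g) (single x₀ 1)
  have h2 := groupHomology.inhomogeneousChains.d_single (A := permRep φ) n g (single x 1)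
  refine (congrArg₂ (· + ·) h1 (congrArg (barContraction θ x₀ n) h2)).trans ?_
  have e1 : (permRep φ).ρ (θ x) (single x₀ (1 : ℤ)) = (single x 1 : X →₀ ℤ) :=
    (permRepresentation_single ..).trans (by rw [hθ])
  have e2 : (permRep φ).ρ (g 0)⁻¹ (single x (1 : ℤ)) = (single (φ (g 0)⁻¹ x) 1 : X →₀ ℤ) :=
    permRepresentation_single ..
  rw [Fin.cons_zero, inv_inv, e1, e2, Fin.sum_univ_succ]
  simp only [map_add, map_sum, map_smul, barContraction_single, Fin.cons_succ,
    contractNth_zero_cons, contractNth_succ_cons, hθ', mul_inv_rev, inv_inv]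
  simp only [Fin.val_zero, zero_add, Fin.val_succ, pow_succ, mul_neg, mul_one, neg_smul,
    neg_neg, Finset.sum_neg_distrib]
  abel

/-- Here `ℤ[X]` is free of rank one over the group ring: its coinvariants are generated by the class
of `x₀`, and the contraction kills all positive degrees. The binomial coefficient encodes these two
cases. -/
lemma generatedBy_groupHomology_of_free {x₀ : X} (h : Function.Bijective fun g => φ g x₀)
    (n : ℕ) : GeneratedBy (groupHomology (permRep φ) n) (Nat.choose 0 n) := by
  let e := Equiv.ofBijective _ h
  have hθ (x : X) : φ (e.symm x) x₀ = x := e.apply_symm_apply x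
  have hθ' (g : Γ) (x : X) : e.symm (φ g x) = g * e.symm x := by
    rw [Equiv.symm_apply_eq]
    show φ g x = φ (g * e.symm x) x₀
    rw [map_mul, Equiv.Perm.mul_apply, hθ]
  cases n with
  | zero =>
    let A := permRep φ
    let p : (X →₀ ℤ) →ₗ[ℤ] groupHomology A 0 := (groupHomology.H0π A).hom
    have hp : Function.Surjective p :=
      (ModuleCat.epi_iff_surjective (groupHomology.H0π A)).1 inferInstance
    have hinv (g : Γ) (a : X →₀ ℤ) : p (permRepresentation φ g a) = p a := by
      have hcoinv : (groupHomology.H0Iso A).hom (p (permRepresentation φ g a)) =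
          (groupHomology.H0Iso A).hom (p a) := by
        have h0 (b : X →₀ ℤ) : (groupHomology.H0Iso A).hom (p b) =
            Representation.Coinvariants.mk A.ρ b :=
          ConcreteCategory.congr_hom (groupHomology.H0π_comp_H0Iso_hom A) b
        rw [h0, h0]
        exact Representation.Coinvariants.mk_self_apply A.ρ g a
      exact (ModuleCat.mono_iff_injective (groupHomology.H0Iso A).hom).1 inferInstance hcoinv
    rw [Nat.choose_self]
    refine ⟨(p ∘ₗ Finsupp.lsingle x₀ ∘ₗ LinearMap.proj 0).toAddMonoidHom, fun y => ?_⟩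
    obtain ⟨a, rfl⟩ := hp y
    show ∃ c : Fin 1 → ℤ, p (single x₀ (c 0)) = p a
    induction a using Finsupp.induction_linear with
    | zero => exact ⟨0, by simp⟩
    | add a b ha hb =>
      obtain ⟨c, hc⟩ := ha
      obtain ⟨d, hd⟩ := hb
      exact ⟨c + d, by rw [Pi.add_apply, single_add, map_add, hc, hd, map_add]⟩
    | single x m =>
      refine ⟨fun _ => m, ?_⟩
      rw [← hinv (e.symm x), permRepresentation_single, hθ]
  | succ n =>
    refine ⟨0, fun y => ⟨0, ?_⟩⟩
    rw [map_zero]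
    symm
    induction y using groupHomology_induction_on with
    | h y =>
      set K := groupHomology.inhomogeneousChains (permRep φ)
      have hc : K.d (n + 1) n (K.iCycles (n + 1) y) = 0 := by
        rw [← ModuleCat.comp_apply, K.iCycles_d]; rfl
      rw [groupHomology.inhomogeneousChains.d_def] at hc
      refine (π_eq_zero_iff K (n + 1) y).2 ?_
      rw [ChainComplex.prev, groupHomology.inhomogeneousChains.d_def]
      refine ⟨barContraction e.symm x₀ (n + 1) (K.iCycles (n + 1) y), ?_⟩
      have := d_barContraction φ hθ hθ' n (K.iCycles (n + 1) y)
      refine Eq.trans ?_ this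
      refine (add_zero _).symm.trans (congrArg (_ + ·) ?_)
      exact ((congrArg (barContraction e.symm x₀ n) hc).trans (map_zero _)).symm

/-- The hypothesis says that `Γ` acts simply transitively on `X × ℤʲ`. Moving one factor `ℤ` into
`X` lowers `j`, and dimension shifting gives Pascal's recursion. -/
theorem generatedBy_groupHomology_permRep {j : ℕ} {X : Type} (φ : Γ →* Equiv.Perm X)
    (ψ : Fin j → Γ →* Multiplicative ℤ) (x₀ : X)
    (h : Function.Bijective fun g => (φ g x₀, fun i => ψ i g)) (n : ℕ) :
    GeneratedBy (groupHomology (permRep φ) n) (j.choose n) := by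
  induction j generalizing X n with
  | zero =>
    refine generatedBy_groupHomology_of_free φ (x₀ := x₀) ?_ n
    exact ((Equiv.prodUnique X (Fin 0 → Multiplicative ℤ)).bijective).comp h
  | succ j ih =>
    have h' : Function.Bijective fun g =>
        (prodIntPerm φ (ψ 0) g (x₀, 0), fun i : Fin j => ψ i.succ g) := by
      constructor
      · intro g g' hg
        refine h.1 ?_
        simp only [prodIntPerm_apply, Prod.mk.injEq, add_zero, funext_iff] at hg ⊢
        exact ⟨hg.1.1, Fin.cases (by simpa using hg.1.2) hg.2⟩
      · rintro ⟨⟨x, m⟩, v⟩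
        obtain ⟨g, hg⟩ := h.2 (x, Fin.cons (Multiplicative.ofAdd m) v)
        simp only [Prod.mk.injEq, funext_iff, Fin.forall_fin_succ, Fin.cons_zero,
          Fin.cons_succ] at hg
        refine ⟨g, ?_⟩
        simp [prodIntPerm_apply, hg]
    have key := ih (prodIntPerm φ (ψ 0)) (fun i => ψ i.succ) (x₀, 0) h'
    cases n with
    | zero => exact generatedBy_groupHomology_zero φ (ψ 0) ((key 0).mono (by simp))
    | succ n =>
      rw [Nat.choose_succ_succ, Nat.add_comm (j.choose n)]
      exact generatedBy_groupHomology_succ φ (ψ 0) (key (n + 1)) (key n)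

/-- `Hₙ(ℤᵐ)` is generated by `m.choose n` elements. -/
theorem generatedBy_H (m n : ℕ) : GeneratedBy (H n (Zn m)) (m.choose n) := by
  let φ : Zn m →* Equiv.Perm Unit := 1
  have h := generatedBy_groupHomology_permRep φ
    (fun i => AddMonoidHom.toMultiplicative (Pi.evalAddMonoidHom (fun _ => ℤ) i)) ()
    ⟨fun g g' hg => Multiplicative.toAdd.injective
      (funext fun i => by simpa using congrFun (congrArg Prod.snd hg) i),
      fun v => ⟨Multiplicative.ofAdd fun i => (v.2 i).toAdd, by ext; simp⟩⟩ n
  -- The trivial module is a retract of the permutation module of a point, so its homology is a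
  -- quotient of the homology just bounded.
  let ε : (permRepresentation φ).IntertwiningMap (Representation.trivial ℤ (Zn m) ℤ) :=
    { toLinearMap := Finsupp.lapply ()
      isIntertwining' g := by
        refine Finsupp.lhom_ext' fun x => LinearMap.ext_ring ?_
        simp [permRepresentation_single] }
  let ε' : (Representation.trivial ℤ (Zn m) ℤ).IntertwiningMap (permRepresentation φ) :=
    { toLinearMap := Finsupp.lsingle ()
      isIntertwining' g := by
        refine LinearMap.ext_ring ?_
        simp [permRepresentation_single] }
  have hε : Rep.ofHom ε' ≫ Rep.ofHom ε = 𝟙 _ := by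
    refine Rep.hom_ext (DFunLike.ext _ _ fun f => ?_)
    show (single () f : Unit →₀ ℤ) () = f
    simp
  let F := groupHomology.functor ℤ (Zn m) n
  have hF : F.map (Rep.ofHom ε') ≫ F.map (Rep.ofHom ε) = 𝟙 _ := by
    rw [← F.map_comp, hε, F.map_id]
  exact h.of_surjective (ModuleCat.Hom.hom (F.map (Rep.ofHom ε))).toAddMonoidHom fun y =>
    ⟨F.map (Rep.ofHom ε') y, ConcreteCategory.congr_hom hF y⟩

end
/-! ## Evaluation of cohomology classes on homology classes -/

section

variable {G : Type} [Group G]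

lemma IsCycle.add {n : ℕ} {z z' : (Fin n → G) →₀ ℤ} (h : IsCycle n z) (h' : IsCycle n z') :
    IsCycle n (z + z') := by
  cases n with
  | zero => trivial
  | succ n => exact (map_add _ _ _).trans (by
      rw [show bd n z = 0 from h, show bd n z' = 0 from h', add_zero])

lemma cls_add {n : ℕ} {z z' : (Fin n → G) →₀ ℤ} (h : IsCycle n z) (h' : IsCycle n z') :
    cls n (z + z') (h.add h') = cls n z h + cls n z' h' := by
  refine Eq.trans ?_ (map_add (groupHomology.π (Rep.trivial ℤ G ℤ) n).hom _ _)
  refine congrArg (groupHomology.π (Rep.trivial ℤ G ℤ) n) ?_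
  apply (ModuleCat.mono_iff_injective (groupHomology.iCycles (Rep.trivial ℤ G ℤ) n)).1 inferInstance
  refine Eq.trans ?_ (map_add (groupHomology.iCycles (Rep.trivial ℤ G ℤ) n).hom _ _).symm
  erw [groupHomology.iCycles_mk, groupHomology.iCycles_mk, groupHomology.iCycles_mk]

lemma cobd_add_eq_zero {n : ℕ} {φ φ' : (Fin n → G) → ℤ} (h : cobd n φ = 0) (h' : cobd n φ' = 0) :
    cobd n (φ + φ') = 0 :=
  (map_add _ _ _).trans (by rw [h, h', add_zero])

lemma cobd_smul_eq_zero {n : ℕ} {φ : (Fin n → G) → ℤ} (c : ℤ) (h : cobd n φ = 0) :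
    cobd n (c • φ) = 0 :=
  (map_smul _ _ _).trans (by rw [h, smul_zero])

lemma cocls_add {n : ℕ} {φ φ' : (Fin n → G) → ℤ} (h : cobd n φ = 0) (h' : cobd n φ' = 0) :
    cocls n (φ + φ') (cobd_add_eq_zero h h') = cocls n φ h + cocls n φ' h' := by
  refine Eq.trans ?_ (map_add (groupCohomology.π (Rep.trivial ℤ G ℤ) n).hom _ _)
  refine congrArg (groupCohomology.π (Rep.trivial ℤ G ℤ) n) ?_
  apply (ModuleCat.mono_iff_injective
    (groupCohomology.iCocycles (Rep.trivial ℤ G ℤ) n)).1 inferInstance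
  refine Eq.trans ?_ (map_add (groupCohomology.iCocycles (Rep.trivial ℤ G ℤ) n).hom _ _).symm
  erw [groupCohomology.iCocycles_mk, groupCohomology.iCocycles_mk, groupCohomology.iCocycles_mk]

/-- The homomorphism sending a cocycle to its class. -/
def coclsHom (n : ℕ) : LinearMap.ker (cobd (G := G) n) →+ coH n G :=
  AddMonoidHom.mk' (fun φ => cocls n φ.1 φ.2) fun φ φ' => cocls_add φ.2 φ'.2

lemma cocls_smul {n : ℕ} {φ : (Fin n → G) → ℤ} (c : ℤ) (h : cobd n φ = 0) :
    cocls n (c • φ) (cobd_smul_eq_zero c h) = c • cocls n φ h :=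
  map_zsmul (coclsHom n) c ⟨φ, h⟩

lemma ev_eq_of_cls_eq {n : ℕ} {ψ : (Fin n → G) → ℤ} (hψ : cobd n ψ = 0)
    {z z' : (Fin n → G) →₀ ℤ} (h : IsCycle n z) (h' : IsCycle n z')
    (e : cls n z h = cls n z' h') : ev ψ z = ev ψ z' := by
  obtain ⟨w, hw⟩ := (cls_eq_iff h h').1 e
  rw [← sub_eq_zero, ← map_sub, ← hw, ← ev_cobd, hψ]
  simp [ev]

/-- Evaluation of the class of a cocycle on homology classes. -/
def pairing {n : ℕ} (ψ : (Fin n → G) → ℤ) (hψ : cobd n ψ = 0) : H n G →+ ℤ :=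
  AddMonoidHom.mk' (fun x => ev ψ (exists_cls x).choose) fun x y => by
    have hx := (exists_cls x).choose_spec
    have hy := (exists_cls y).choose_spec
    have hxy := (exists_cls (x + y)).choose_spec
    rw [← map_add]
    refine ev_eq_of_cls_eq hψ hxy.choose (hx.choose.add hy.choose) ?_
    rw [cls_add hx.choose hy.choose, hx.choose_spec, hy.choose_spec, hxy.choose_spec]

lemma pairing_cls {n : ℕ} {ψ : (Fin n → G) → ℤ} (hψ : cobd n ψ = 0) {z : (Fin n → G) →₀ ℤ}
    (hz : IsCycle n z) : pairing ψ hψ (cls n z hz) = ev ψ z :=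
  ev_eq_of_cls_eq hψ (exists_cls (cls n z hz)).choose_spec.choose hz
    (exists_cls (cls n z hz)).choose_spec.choose_spec

/-! ### Naturality, and products of degree-one classes -/

/-- The map of bar chains induced by a homomorphism. -/
def chainMap {G' : Type} [Group G'] (f : G →* G') (n : ℕ) :
    ((Fin n → G) →₀ ℤ) →ₗ[ℤ] ((Fin n → G') →₀ ℤ) :=
  Finsupp.lmapDomain ℤ ℤ fun g => f ∘ g

lemma chainMap_single {G' : Type} [Group G'] (f : G →* G') {n : ℕ} (g : Fin n → G) (c : ℤ) :
    chainMap f n (single g c) = single (f ∘ g) c :=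
  Finsupp.mapDomain_single

lemma bd_chainMap {G' : Type} [Group G'] (f : G →* G') (n : ℕ) (z : (Fin (n + 1) → G) →₀ ℤ) :
    bd n (chainMap f (n + 1) z) = chainMap f n (bd n z) := by
  suffices h : bd n ∘ₗ chainMap f (n + 1) = chainMap f n ∘ₗ bd n from LinearMap.congr_fun h z
  refine Finsupp.lhom_ext' fun g => LinearMap.ext_ring ?_
  simp only [LinearMap.comp_apply, Finsupp.lsingle_apply, chainMap_single]
  rw [bd_single, bd_single]
  simp only [map_add, map_sum, map_smul, chainMap_single]
  refine congrArg₂ (· + ·) rfl (Finset.sum_congr rfl fun j _ => ?_)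
  congr 2
  funext k
  simp only [Fin.contractNth, Function.comp_apply]
  split_ifs <;> simp

lemma IsCycle.chainMap {G' : Type} [Group G'] (f : G →* G') {n : ℕ} {z : (Fin n → G) →₀ ℤ}
    (hz : IsCycle n z) : IsCycle n (chainMap f n z) := by
  cases n with
  | zero => trivial
  | succ n =>
    refine (bd_chainMap f n z).trans ?_
    rw [show bd n z = 0 from hz, map_zero]

lemma pushforward_cls {G' : Type} [Group G'] (f : G →* G') {n : ℕ} {z : (Fin n → G) →₀ ℤ}
    (hz : IsCycle n z) :
    pushforward f n (cls n z hz) = cls n (chainMap f n z) (hz.chainMap f) := by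
  let ι : Rep.trivial ℤ G ℤ ⟶ Rep.res f (Rep.trivial ℤ G' ℤ) :=
    Rep.ofHom ⟨LinearMap.id, fun _ => rfl⟩
  refine (groupHomology.π_map_apply f ι n _).trans ?_
  refine congrArg (groupHomology.π (Rep.trivial ℤ G' ℤ) n) ?_
  apply (ModuleCat.mono_iff_injective
    (groupHomology.iCycles (Rep.trivial ℤ G' ℤ) n)).1 inferInstance
  refine (ConcreteCategory.congr_hom
    (HomologicalComplex.cyclesMap_i (groupHomology.chainsMap f ι) n) _).trans ?_
  rw [ModuleCat.comp_apply]
  erw [groupHomology.iCycles_mk, groupHomology.iCycles_mk]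
  show Finsupp.mapRange.linearMap (LinearMap.id : ℤ →ₗ[ℤ] ℤ) (Finsupp.lmapDomain ℤ ℤ (f ∘ ·) z) = _
  rw [Finsupp.mapRange.linearMap_id]
  rfl

/-- The cochain `f₁ ∪ ⋯ ∪ fₙ` of homomorphisms `fᵢ`. -/
def prodCochain {n : ℕ} (f : Fin n → Additive G →+ ℤ) : (Fin n → G) → ℤ :=
  fun g => ∏ i, f i (Additive.ofMul (g i))

lemma cobd_hom (f : Additive G →+ ℤ) :
    cobd 1 (fun g : Fin 1 → G => f (Additive.ofMul (g 0))) = 0 := by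
  funext g
  rw [cobd_apply]
  simp [Fin.sum_univ_two, Fin.contractNth]

lemma cupCochain_prodCochain {n : ℕ} (h : 1 + n = n + 1) (f : Additive G →+ ℤ)
    (F : Fin n → Additive G →+ ℤ) :
    cupCochain h (fun g => f (Additive.ofMul (g 0))) (prodCochain F) =
      prodCochain (Fin.cons f F : Fin (n + 1) → Additive G →+ ℤ) := by
  funext g
  rw [prodCochain, Fin.prod_univ_succ]
  refine congrArg₂ (· * ·) rfl (Finset.prod_congr rfl fun i _ => ?_)
  simp only [back, Fin.cons_succ]
  congr 3
  ext
  simp [add_comm]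

lemma cobd_prodCochain {n : ℕ} (f : Fin n → Additive G →+ ℤ) : cobd n (prodCochain f) = 0 := by
  induction n with
  | zero =>
    funext g
    rw [cobd_apply]
    simp [prodCochain]
  | succ n ih =>
    rw [← Fin.cons_self_tail f, ← cupCochain_prodCochain (add_comm 1 n)]
    exact cobd_cupCochain_eq_zero _ (cobd_hom _) (ih _)

lemma ev_prodCochain_chainMap {G' : Type} [Group G'] (f : G →* G') {n : ℕ}
    (F : Fin n → Additive G' →+ ℤ) (z : (Fin n → G) →₀ ℤ) :
    ev (prodCochain F) (chainMap f n z) =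
      ev (prodCochain fun i => (F i).comp (MonoidHom.toAdditive f)) z := by
  suffices h : ev (prodCochain F) ∘ₗ chainMap f n =
      ev (prodCochain fun i => (F i).comp (MonoidHom.toAdditive f)) from LinearMap.congr_fun h z
  refine Finsupp.lhom_ext' fun g => LinearMap.ext_ring ?_
  simp only [LinearMap.comp_apply, Finsupp.lsingle_apply, chainMap_single, ev_single]
  rfl

/-- Evaluation of the product of the classes of homomorphisms `fᵢ`. -/
def prodPairing {n : ℕ} (f : Fin n → Additive G →+ ℤ) : H n G →+ ℤ :=
  pairing (prodCochain f) (cobd_prodCochain f)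

lemma prodPairing_pushforward {G' : Type} [Group G'] (f : G →* G') {n : ℕ}
    (F : Fin n → Additive G' →+ ℤ) (x : H n G) :
    prodPairing F (pushforward f n x) =
      prodPairing (fun i => (F i).comp (MonoidHom.toAdditive f)) x := by
  obtain ⟨z, hz, rfl⟩ := exists_cls x
  rw [pushforward_cls, prodPairing, prodPairing, pairing_cls, pairing_cls,
    ev_prodCochain_chainMap]

end

/-- The signed sum over permutations defining the Pontryagin product becomes the Leibniz formula. -/
lemma ev_prodCochain_pontryaginChain {G : Type} [CommGroup G] {n : ℕ}
    (F : Fin n → Additive G →+ ℤ) (v : Fin n → G) :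
    ev (prodCochain F) (pontryaginChain v) =
      (Matrix.of fun i j => F i (Additive.ofMul (v j))).det := by
  rw [pontryaginChain, map_sum, ← Matrix.det_transpose, Matrix.det_apply]
  refine Finset.sum_congr rfl fun σ _ => ?_
  rw [← mul_one ((Equiv.Perm.sign σ : ℤˣ) : ℤ), ← smul_eq_mul, ← Finsupp.smul_single, map_smul,
    ev_single]
  rfl

/-! ## Determinants with two distinguished rows -/

variable {n : ℕ}

/-- The bilinear form `(u, v) ↦ det(u, v, F)`. -/
def consDet (F : Fin n → Fin (n + 2) → ℤ) : (Fin (n + 2) → ℤ) →ₗ[ℤ] (Fin (n + 2) → ℤ) →ₗ[ℤ] ℤ :=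
  LinearMap.mk₂ ℤ
    (fun u v => (((Matrix.detRowAlternating (R := ℤ) (n := Fin (n + 2))).curryLeft u).curryLeft v) F)
    (fun u u' v => by simp)
    (fun c u v => congrArg
      (fun g : (Fin (n + 2) → ℤ) [⋀^Fin (n + 1)]→ₗ[ℤ] ℤ => g.curryLeft v F) (map_smul _ c u))
    (fun u v v' => by simp)
    (fun c u v => congrArg (fun g : (Fin (n + 2) → ℤ) [⋀^Fin n]→ₗ[ℤ] ℤ => g F) (map_smul _ c v))

lemma consDet_apply (F : Fin n → Fin (n + 2) → ℤ) (u v : Fin (n + 2) → ℤ) :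
    consDet F u v = Matrix.det (Matrix.of (Matrix.vecCons u (Matrix.vecCons v F))) := rfl

lemma consDet_self (F : Fin n → Fin (n + 2) → ℤ) (u : Fin (n + 2) → ℤ) : consDet F u u = 0 :=
  (Matrix.det_zero_of_row_eq (M := Matrix.of (Matrix.vecCons u (Matrix.vecCons u F)))
    (i := 0) (j := Fin.succ 0) (Fin.succ_ne_zero _).symm rfl :)

lemma consDet_swap (F : Fin n → Fin (n + 2) → ℤ) (u v : Fin (n + 2) → ℤ) :
    consDet F v u = -consDet F u v :=
  (LinearMap.IsAlt.neg (B := consDet F) (consDet_self F) u v).symm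

lemma consDet_row_left (F : Fin n → Fin (n + 2) → ℤ) (k : Fin n) (v : Fin (n + 2) → ℤ) :
    consDet F (F k) v = 0 :=
  Matrix.det_zero_of_row_eq (M := Matrix.of (Matrix.vecCons (F k) (Matrix.vecCons v F)))
    (i := 0) (j := k.succ.succ) (Fin.succ_ne_zero _).symm rfl

lemma consDet_row_right (F : Fin n → Fin (n + 2) → ℤ) (k : Fin n) (u : Fin (n + 2) → ℤ) :
    consDet F u (F k) = 0 := by
  rw [consDet_swap, consDet_row_left, neg_zero]

lemma consDet_vecMul (F : Fin n → Fin (n + 2) → ℤ) (u v : Fin (n + 2) → ℤ)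
    (P : Matrix (Fin (n + 2)) (Fin (n + 2)) ℤ) :
    consDet (fun k => Matrix.vecMul (F k) P) (Matrix.vecMul u P) (Matrix.vecMul v P) =
      P.det * consDet F u v := by
  rw [consDet_apply, consDet_apply, mul_comm, ← Matrix.det_mul]
  congr 1
  ext i j
  refine Fin.cases rfl (fun i => Fin.cases rfl (fun i => rfl) i) i

/-- `∑ᵢⱼ Uᵢⱼ det(eᵢ, eⱼ, F)`. -/
def quadDet (U : Matrix (Fin (n + 2)) (Fin (n + 2)) ℤ) (F : Fin n → Fin (n + 2) → ℤ) : ℤ :=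
  ∑ i, ∑ j, U i j * consDet F (Pi.single i 1) (Pi.single j 1)

lemma quadDet_eq_trace (U : Matrix (Fin (n + 2)) (Fin (n + 2)) ℤ) (F : Fin n → Fin (n + 2) → ℤ) :
    quadDet U F = (U * (LinearMap.toMatrix₂' ℤ (consDet F)).transpose).trace := by
  simp [quadDet, Matrix.trace, Matrix.mul_apply, LinearMap.toMatrix₂'_apply]

lemma quadDet_transpose (U : Matrix (Fin (n + 2)) (Fin (n + 2)) ℤ) (F : Fin n → Fin (n + 2) → ℤ) :
    quadDet U.transpose F = -quadDet U F := by
  rw [quadDet, quadDet, Finset.sum_comm, ← Finset.sum_neg_distrib]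
  refine Finset.sum_congr rfl fun i _ => ?_
  rw [← Finset.sum_neg_distrib]
  refine Finset.sum_congr rfl fun j _ => ?_
  rw [consDet_swap F (Pi.single i 1), Matrix.transpose_apply, mul_neg]

lemma quadDet_sub (U V : Matrix (Fin (n + 2)) (Fin (n + 2)) ℤ) (F : Fin n → Fin (n + 2) → ℤ) :
    quadDet (U - V) F = quadDet U F - quadDet V F := by
  simp [quadDet, sub_mul, Finset.sum_sub_distrib]

lemma quadDet_smul (c : ℤ) (U : Matrix (Fin (n + 2)) (Fin (n + 2)) ℤ) (F : Fin n → Fin (n + 2) → ℤ) :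
    quadDet (c • U) F = c * quadDet U F := by
  simp [quadDet, mul_assoc, Finset.mul_sum]

/-- Multiplying all rows by `P` scales the determinant by `det P`; written as a trace against the
Gram matrix of `consDet F`, the claim follows by cyclicity. -/
lemma quadDet_conj (U P : Matrix (Fin (n + 2)) (Fin (n + 2)) ℤ) (F : Fin n → Fin (n + 2) → ℤ) :
    quadDet (P.transpose * U * P) (fun k => Matrix.vecMul (F k) P) = P.det * quadDet U F := by
  have h : P * LinearMap.toMatrix₂' ℤ (consDet fun k => Matrix.vecMul (F k) P) * P.transpose =
      P.det • LinearMap.toMatrix₂' ℤ (consDet F) := by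
    have := LinearMap.toMatrix₂'_compl₁₂ (R := ℤ) (consDet fun k => Matrix.vecMul (F k) P)
      (Matrix.vecMulLinear P) (Matrix.vecMulLinear P)
    ext i j
    rw [Matrix.smul_apply, LinearMap.toMatrix₂'_apply, smul_eq_mul, ← consDet_vecMul]
    have e : LinearMap.toMatrix' (Matrix.vecMulLinear P) = P.transpose := by
      ext i j
      simp [LinearMap.toMatrix'_apply]
    rw [e, Matrix.transpose_transpose] at this
    rw [← this, LinearMap.toMatrix₂'_apply]
    rfl
  rw [quadDet_eq_trace, quadDet_eq_trace, Matrix.mul_assoc, Matrix.mul_assoc, Matrix.trace_mul_comm,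
    ← smul_eq_mul (P.det), ← Matrix.trace_smul, ← Matrix.mul_smul, ← Matrix.transpose_smul, ← h]
  simp only [Matrix.transpose_mul, Matrix.transpose_transpose, Matrix.mul_assoc]

/-- Let `F` consist of the standard vectors other than `eᵢ, eⱼ`. Then only the terms for `(i, j)`
and `(j, i)` survive, with opposite signs, and `δ` is the sign of the permutation that orders the
rows. -/
lemma exists_quadDet_eq {i j : Fin (n + 2)} (hij : i ≠ j) :
    ∃ (F : Fin n → Fin (n + 2) → ℤ) (δ : ℤ), IsUnit δ ∧
      ∀ V : Matrix (Fin (n + 2)) (Fin (n + 2)) ℤ, quadDet V F = δ * (V i j - V j i) := by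
  obtain ⟨σ, hσ0, hσ1⟩ : ∃ σ : Equiv.Perm (Fin (n + 2)), σ 0 = i ∧ σ 1 = j := by
    let τ := Equiv.swap 0 i
    have h0 : τ 0 = i := Equiv.swap_apply_left _ _
    have h1 : i ≠ τ 1 := by
      rw [← h0]
      exact fun h => absurd (τ.injective h) (by simp)
    refine ⟨Equiv.swap (τ 1) j * τ, ?_, ?_⟩
    · rw [Equiv.Perm.mul_apply, h0, Equiv.swap_apply_of_ne_of_ne h1 hij]
    · rw [Equiv.Perm.mul_apply, Equiv.swap_apply_left]
  let F : Fin n → Fin (n + 2) → ℤ := fun k => Pi.single (σ k.succ.succ) 1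
  refine ⟨F, consDet F (Pi.single i 1) (Pi.single j 1), ?_, fun V => ?_⟩
  · have : Matrix.of (Matrix.vecCons (Pi.single i 1) (Matrix.vecCons (Pi.single j 1) F)) =
        (1 : Matrix (Fin (n + 2)) (Fin (n + 2)) ℤ).submatrix σ id := by
      ext a b
      have h (c : Fin (n + 2)) : (Pi.single c 1 : Fin (n + 2) → ℤ) b =
          (1 : Matrix (Fin (n + 2)) (Fin (n + 2)) ℤ) c b := by
        rw [Matrix.one_apply, Pi.single_apply]
        simp only [eq_comm]
      refine Fin.cases ?_ (fun a => Fin.cases ?_ (fun a => ?_) a) a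
      · exact (h i).trans (by rw [← hσ0]; rfl)
      · exact (h j).trans (by rw [← hσ1]; rfl)
      · exact h _
    rw [consDet_apply, this, Matrix.det_permute, Matrix.det_one, mul_one]
    exact ((Equiv.Perm.sign σ).isUnit)
  · have hl (k : Fin n) (v : Fin (n + 2) → ℤ) : consDet F (Pi.single (σ k.succ.succ) 1) v = 0 :=
      consDet_row_left F k v
    have hr (k : Fin n) (v : Fin (n + 2) → ℤ) : consDet F v (Pi.single (σ k.succ.succ) 1) = 0 :=
      consDet_row_right F k v
    have h1 : σ (Fin.succ 0) = j := hσ1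
    have hV : quadDet V F = ∑ a, ∑ b, V (σ a) (σ b) *
        consDet F (Pi.single (σ a) 1) (Pi.single (σ b) 1) := by
      rw [quadDet, ← Equiv.sum_comp σ]
      exact Finset.sum_congr rfl fun a _ => (Equiv.sum_comp σ _).symm
    rw [hV, Fin.sum_univ_succ, Fin.sum_univ_succ]
    simp only [Fin.sum_univ_succ (n := n + 1), Fin.sum_univ_succ (n := n), hl, hr, hσ0, h1,
      consDet_self, consDet_swap F (Pi.single i 1) (Pi.single j 1), mul_zero,
      Finset.sum_const_zero, add_zero]
    ring

/-! ## The normal form of an alternating form over `ℤ` -/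

section

variable {R V : Type*} [CommRing R] [IsPrincipalIdealRing R] [AddCommGroup V]
  [Module R V]

/-- By Bézout the gcd of the two values is itself a value of `ω v₀`, so minimality forbids it from
being a proper divisor of `ω v₀ w₀`. -/
lemma dvd_of_minimal (ω : V →ₗ[R] V →ₗ[R] R) {v₀ w₀ : V} (h0 : ω v₀ w₀ ≠ 0)
    (hmin : ∀ v w, ω v w ≠ 0 → ¬DvdNotUnit (ω v w) (ω v₀ w₀)) (w : V) :
    ω v₀ w₀ ∣ ω v₀ w := by
  obtain ⟨x, y, hxy⟩ := IsBezout.gcd_eq_sum (ω v₀ w₀) (ω v₀ w)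
  have hg : ω v₀ (x • w₀ + y • w) = IsBezout.gcd (ω v₀ w₀) (ω v₀ w) := by
    rw [map_add, map_smul, map_smul, smul_eq_mul, smul_eq_mul, hxy]
  have hl := IsBezout.gcd_dvd_left (ω v₀ w₀) (ω v₀ w)
  refine dvd_trans ?_ (IsBezout.gcd_dvd_right (ω v₀ w₀) (ω v₀ w))
  by_contra h
  refine hmin v₀ (x • w₀ + y • w) ?_ ?_
  · rw [hg]
    exact ne_zero_of_dvd_ne_zero h0 hl
  · rw [hg]
    exact dvdNotUnit_of_dvd_of_not_dvd hl h

/-- A nonzero value minimal for strict divisibility exists in a principal ideal domain; it first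
divides the values involving `v₀` or `w₀`, then all values. -/
lemma exists_forall_dvd [IsDomain R] (ω : V →ₗ[R] V →ₗ[R] R) (hω : ω.IsAlt) (h : ω ≠ 0) :
    ∃ v₀ w₀, ω v₀ w₀ ≠ 0 ∧ ∀ v w, ω v₀ w₀ ∣ ω v w := by
  have hex : {r : R | r ≠ 0 ∧ ∃ v w, ω v w = r}.Nonempty := by
    by_contra hne
    refine h (LinearMap.ext₂ fun v w => ?_)
    by_contra h'
    exact hne ⟨_, h', v, w, rfl⟩
  obtain ⟨_, ⟨h0, v₀, w₀, rfl⟩, hk⟩ :=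
    (wellFounded_dvdNotUnit (α := R)).has_min _ hex
  have hmin (v w : V) (hvw : ω v w ≠ 0) : ¬DvdNotUnit (ω v w) (ω v₀ w₀) :=
    hk _ ⟨hvw, v, w, rfl⟩
  have hsymm (v w : V) : ω v w = -ω w v := (hω.neg w v).symm
  refine ⟨v₀, w₀, h0, fun v w => ?_⟩
  have hv₀ (w : V) : ω v₀ w₀ ∣ ω v₀ w := dvd_of_minimal ω h0 hmin w
  have hw₀ (w : V) : ω v₀ w₀ ∣ ω w₀ w := by
    have := dvd_of_minimal ω.flip (v₀ := w₀) (w₀ := v₀) h0 (fun v w => hmin w v) w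
    rw [hsymm w₀ w, dvd_neg]
    exact this
  obtain ⟨x, hx⟩ : ω v₀ w₀ ∣ ω v w₀ := by
    rw [hsymm v w₀, dvd_neg]
    exact hw₀ v
  -- Since `v - x • v₀` pairs to zero with `w₀`, adding it to `v₀` preserves the minimal value, and
  -- `dvd_of_minimal` applies to the new first vector as well.
  have h1 : ω (v₀ + (v - x • v₀)) w₀ = ω v₀ w₀ := by
    simp only [map_add, map_sub, map_smul, LinearMap.add_apply, LinearMap.sub_apply,
      LinearMap.smul_apply, hx, smul_eq_mul]
    ring
  have h2 := dvd_of_minimal ω (v₀ := v₀ + (v - x • v₀)) (w₀ := w₀) (by rwa [h1])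
    (by simpa only [h1] using hmin) w
  rw [h1] at h2
  simp only [map_add, map_sub, map_smul, LinearMap.add_apply, LinearMap.sub_apply,
      LinearMap.smul_apply, smul_eq_mul] at h2
  have h3 := (dvd_add_right (hv₀ w)).1 h2
  exact (dvd_sub_left ((hv₀ w).mul_left x)).1 h3

end

/-- The standard alternating form on `R²`. -/
def planeForm (R : Type*) [CommRing R] : Matrix (Fin 2) (Fin 2) R := !![0, 1; -1, 0]

/-- The equivalence splitting off the first summand. -/
def sumProdEquiv (n : ℕ) : Fin 2 ⊕ Fin n × Fin 2 ≃ Fin (n + 1) × Fin 2 :=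
  Equiv.ofBijective (Sum.elim (fun s => (0, s)) fun p => (p.1.succ, p.2)) (by
    constructor
    · rintro (s | ⟨i, s⟩) (t | ⟨j, t⟩) h <;> simp_all [Fin.ext_iff]
    · rintro ⟨i, s⟩
      refine Fin.cases ⟨Sum.inl s, rfl⟩ (fun i => ⟨Sum.inr (i, s), rfl⟩) i)

lemma sumProdEquiv_symm_zero (n : ℕ) (s : Fin 2) : (sumProdEquiv n).symm (0, s) = Sum.inl s :=
  (Equiv.symm_apply_eq _).2 rfl

lemma sumProdEquiv_symm_succ (n : ℕ) (i : Fin n) (s : Fin 2) :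
    (sumProdEquiv n).symm (i.succ, s) = Sum.inr (i, s) :=
  (Equiv.symm_apply_eq _).2 rfl

/-- Vectors realising a value that divides all others span a plane which splits off with its
orthogonal complement. The common divisor `m` is carried through the induction to produce the
divisibility chain. -/
theorem exists_basis_of_isAlt (n : ℕ) {R V : Type*} [CommRing R] [IsDomain R]
    [IsPrincipalIdealRing R] [AddCommGroup V] [Module R V]
    [Module.Free R V] [Module.Finite R V] (hV : Module.finrank R V = n * 2)
    (ω : V →ₗ[R] V →ₗ[R] R) (hω : ω.IsAlt) {m : R} (hm : ∀ v w, m ∣ ω v w) :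
    ∃ (b : Module.Basis (Fin n × Fin 2) R V) (d : Fin n → R), (∀ i, m ∣ d i) ∧
      (∀ i j, i ≤ j → d i ∣ d j) ∧
      ∀ i j s t, ω (b (i, s)) (b (j, t)) = if i = j then d i * planeForm R s t else 0 := by
  induction n generalizing V m with
  | zero =>
    exact ⟨(Module.finBasisOfFinrankEq R V hV).reindex finProdFinEquiv.symm, fun _ => 0, by simp,
      by simp, fun i => i.elim0⟩
  | succ n ih =>
    by_cases h0 : ω = 0
    · exact ⟨(Module.finBasisOfFinrankEq R V hV).reindex finProdFinEquiv.symm, fun _ => 0, by simp,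
        by simp, by simp [h0]⟩
    obtain ⟨v₀, w₀, ha, hdvd⟩ := exists_forall_dvd ω hω h0
    set a := ω v₀ w₀ with ha_def
    have hsymm : ω w₀ v₀ = -a := (hω.neg v₀ w₀).symm
    let K : Submodule R V := LinearMap.ker (ω v₀) ⊓ LinearMap.ker (ω w₀)
    have hKv (k : K) : ω v₀ k = 0 := k.2.1
    have hKw (k : K) : ω w₀ k = 0 := k.2.2
    have hKv' (k : K) : ω k v₀ = 0 := by rw [← hω.neg, hKv, neg_zero]
    have hKw' (k : K) : ω k w₀ = 0 := by rw [← hω.neg, hKw, neg_zero]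
    let T : (Fin 2 → R) × K →ₗ[R] V :=
      (Fintype.linearCombination R ![v₀, w₀]).coprod K.subtype
    have hT (c : Fin 2 → R) (k : K) : T (c, k) = c 0 • v₀ + c 1 • w₀ + k := by
      simp [T, Fintype.linearCombination_apply, Fin.sum_univ_two]
    have hT_bij : Function.Bijective T := by
      constructor
      · refine (injective_iff_map_eq_zero T).2 ?_
        rintro ⟨c, k⟩ hck
        rw [hT] at hck
        have h1 := congrArg (ω v₀) hck
        have h2 := congrArg (ω w₀) hck
        simp only [map_add, map_smul, hω.self_eq_zero, hKv, hKw, hsymm, ← ha_def, map_zero,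
          smul_eq_mul, mul_zero, zero_add, add_zero, mul_neg, neg_eq_zero, mul_eq_zero, ha,
          or_false] at h1 h2
        rw [h1, h2, zero_smul, zero_smul, zero_add, zero_add] at hck
        refine Prod.ext (funext fun i => ?_) (Subtype.ext hck)
        fin_cases i
        · exact h2
        · exact h1
      · intro v
        obtain ⟨x, hx⟩ := hdvd w₀ v
        obtain ⟨y, hy⟩ := hdvd v₀ v
        -- Orthogonal projection to the plane: its coefficients lie in `R` because `a` divides `ω w₀
        -- v` and `ω v₀ v`.
        refine ⟨(![-x, y], ⟨v - ((-x) • v₀ + y • w₀), ?_, ?_⟩), ?_⟩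
        · show ω v₀ (v - ((-x) • v₀ + y • w₀)) = 0
          simp only [map_sub, map_add, map_smul, hy, hω.self_eq_zero, ← ha_def,
            smul_eq_mul]
          ring
        · show ω w₀ (v - ((-x) • v₀ + y • w₀)) = 0
          simp only [map_sub, map_add, map_smul, hx, hω.self_eq_zero, hsymm,
            smul_eq_mul]
          ring
        · rw [hT]
          simp
    let e := LinearEquiv.ofBijective T hT_bij
    have hK : Module.finrank R K = n * 2 := by
      have := e.finrank_eq
      rw [Module.finrank_prod, Module.finrank_fin_fun, hV] at this
      omega
    -- Taking `a` as the new common divisor makes it divide all later coefficients.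
    obtain ⟨b, d, had, hd, hb⟩ := ih hK (ω.domRestrict₁₂ K K) (fun k => hω k)
      (m := a) (fun k l => hdvd k l)
    let B := (((Pi.basisFun R (Fin 2)).prod b).map e).reindex (sumProdEquiv n)
    have hB0 (s : Fin 2) : B (0, s) = ![v₀, w₀] s := by
      simp only [B, Module.Basis.reindex_apply, sumProdEquiv_symm_zero, Module.Basis.map_apply]
      show T _ = _
      rw [Module.Basis.prod_apply]
      simp [hT]
      fin_cases s <;> simp
    have hBs (i : Fin n) (s : Fin 2) : B (i.succ, s) = b (i, s) := by
      simp only [B, Module.Basis.reindex_apply, sumProdEquiv_symm_succ, Module.Basis.map_apply]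
      show T _ = _
      rw [Module.Basis.prod_apply]
      simp [hT]
    refine ⟨B, Fin.cons a d, Fin.cases (hm _ _) fun i => (hm _ _).trans (had i), ?_, ?_⟩
    · refine Fin.cases (Fin.cases (by simp) fun j _ => had j)
        fun i => Fin.cases (fun h => absurd h (by simp)) fun j h => hd i j (by simpa using h)
    · intro i j s t
      refine Fin.cases ?_ (fun i => ?_) i <;> refine Fin.cases ?_ (fun j => ?_) j
      · rw [hB0, hB0]
        fin_cases s <;> fin_cases t <;> simp [planeForm, hsymm, hω.self_eq_zero, ← ha_def]
      · rw [hB0, hBs]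
        fin_cases s <;> simp [hKv, hKw, (Fin.succ_ne_zero j).symm]
      · rw [hB0, hBs]
        fin_cases t <;> simp [hKv', hKw']
      · rw [hBs, hBs]
        simpa [LinearMap.domRestrict₁₂_apply] using hb i j s t

/-! ### Normal form in rank six with determinant one -/

/-- The Gram matrix of the alternating form `a x₁x₂ + b x₃x₄ + c x₅x₆`. -/
def normalMatrix (a b c : ℤ) : Matrix (Fin 6) (Fin 6) ℤ :=
  !![0, a, 0, 0, 0, 0; -a, 0, 0, 0, 0, 0; 0, 0, 0, b, 0, 0; 0, 0, -b, 0, 0, 0;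
    0, 0, 0, 0, 0, c; 0, 0, 0, 0, -c, 0]

lemma exists_mul_self_eq_one (d : ℤ) : ∃ s : ℤ, s * s = 1 ∧ 0 ≤ s * d := by
  rcases le_total 0 d with h | h
  · exact ⟨1, by norm_num, by simpa using h⟩
  · exact ⟨-1, by norm_num, by simpa using h⟩

lemma mul_dvd_mul_of_mul_self_eq_one {s t d e : ℤ} (hs : s * s = 1) (h : d ∣ e) :
    s * d ∣ t * e := by
  obtain ⟨q, rfl⟩ := h
  exact ⟨s * t * q, by linear_combination (-t * d * q) * hs⟩

lemma normalMatrix_diag (d : Fin 3 → ℤ) (s₀ s₁ s₂ : ℤ) (k l : Fin 6) :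
    ![s₀, 1, s₁, 1, s₂, 1] k * ![s₀, 1, s₁, 1, s₂, 1] l * normalMatrix (d 0) (d 1) (d 2) k l =
      normalMatrix (s₀ * d 0) (s₁ * d 1) (s₂ * d 2) k l := by
  fin_cases k <;> fin_cases l <;> simp [normalMatrix]

lemma normalMatrix_finProdFinEquiv (d : Fin 3 → ℤ) (i j : Fin 3) (s t : Fin 2) :
    (normalMatrix (d 0) (d 1) (d 2) : Matrix (Fin (3 * 2)) (Fin (3 * 2)) ℤ)
      (finProdFinEquiv (i, s)) (finProdFinEquiv (j, t)) =
      if i = j then d i * planeForm ℤ s t else 0 := by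
  fin_cases i <;> fin_cases j <;> fin_cases s <;> fin_cases t <;>
    simp [normalMatrix, planeForm, finProdFinEquiv]

lemma transpose_mul_mul_apply {n : Type*} [Fintype n] (P W : Matrix n n ℤ) (k l : n) :
    (P.transpose * W * P) k l = dotProduct (P.col k) (W.mulVec (P.col l)) := by
  rw [Matrix.mul_assoc, Matrix.mul_apply_eq_vecMul]
  rfl

theorem exists_conj_eq_normalMatrix (U : Matrix (Fin 6) (Fin 6) ℤ) :
    ∃ (P : Matrix (Fin 6) (Fin 6) ℤ) (a b c : ℤ), P.det = 1 ∧ a ∣ b ∧ b ∣ c ∧ 0 ≤ a ∧ 0 ≤ b ∧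
      P.transpose * (U - U.transpose) * P = normalMatrix a b c := by
  let ω : (Fin 6 → ℤ) →ₗ[ℤ] (Fin 6 → ℤ) →ₗ[ℤ] ℤ := Matrix.toLinearMap₂' ℤ (U - U.transpose)
  have hω_apply (v w : Fin 6 → ℤ) : ω v w = dotProduct v ((U - U.transpose).mulVec w) :=
    Matrix.toLinearMap₂'_apply' _ v w
  have hω : ω.IsAlt := fun v => by
    rw [hω_apply, Matrix.sub_mulVec, dotProduct_sub, Matrix.mulVec_transpose,
      dotProduct_comm v (Matrix.vecMul v U), ← Matrix.dotProduct_mulVec, sub_self]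
  obtain ⟨b, d, -, hd, hb⟩ := exists_basis_of_isAlt 3 (by simp) ω hω (m := 1) (by simp)
  let B : Module.Basis (Fin 6) ℤ (Fin 6 → ℤ) := b.reindex finProdFinEquiv
  have hB (k l : Fin 6) : ω (B k) (B l) = normalMatrix (d 0) (d 1) (d 2) k l := by
    obtain ⟨⟨i, s⟩, rfl⟩ := (finProdFinEquiv (m := 3) (n := 2)).surjective k
    obtain ⟨⟨j, t⟩, rfl⟩ := (finProdFinEquiv (m := 3) (n := 2)).surjective l
    refine Eq.trans ?_ (normalMatrix_finProdFinEquiv d i j s t).symm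
    rw [← hb]
    simp [B]
  let P₀ := (Pi.basisFun ℤ (Fin 6)).toMatrix B
  have hP₀ : P₀.det * P₀.det = 1 := by
    have : IsUnit P₀.det := by
      rw [← Module.Basis.det_apply]
      exact Module.Basis.isUnit_det _ B
    exact Int.isUnit_mul_self this
  obtain ⟨s₀, hs₀, h₀⟩ := exists_mul_self_eq_one (d 0)
  obtain ⟨s₁, hs₁, h₁⟩ := exists_mul_self_eq_one (d 1)
  -- The first vector of each pair is rescaled by a sign: `s₀` and `s₁` make `a` and `b`
  -- nonnegative, while `s₂` is then forced by the requirement of total determinant `1`.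
  let s₂ := s₀ * s₁ * P₀.det
  let S : Fin 6 → ℤ := ![s₀, 1, s₁, 1, s₂, 1]
  have hcol (k : Fin 6) : (P₀ * Matrix.diagonal S).col k = S k • B k := by
    ext i
    simp [P₀, Matrix.col, Module.Basis.toMatrix_apply, mul_comm]
  refine ⟨P₀ * Matrix.diagonal S, s₀ * d 0, s₁ * d 1, s₂ * d 2, ?_,
    mul_dvd_mul_of_mul_self_eq_one hs₀ (hd 0 1 (by decide)),
    mul_dvd_mul_of_mul_self_eq_one hs₁ (hd 1 2 (by decide)), h₀, h₁, ?_⟩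
  · rw [Matrix.det_mul, Matrix.det_diagonal]
    simp only [S, s₂, Fin.prod_univ_six]
    simp
    linear_combination (s₀ * s₀ * s₁ * s₁) * hP₀ + s₁ * s₁ * hs₀ + hs₁
  · ext k l
    rw [transpose_mul_mul_apply, hcol, hcol, ← hω_apply, map_smul, LinearMap.map_smul₂, hB,
      ← normalMatrix_diag, smul_eq_mul, smul_eq_mul]
    ring

/-! ## Invariants of the normal form -/

/-- The Pfaffian of an alternating `4 × 4` array. -/
def pf₄ (m : Fin 4 → Fin 4 → ℤ) : ℤ := m 0 1 * m 2 3 - m 0 2 * m 1 3 + m 0 3 * m 1 2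

/-- The Pfaffian of an alternating `6 × 6` array. -/
def pf₆ (m : Fin 6 → Fin 6 → ℤ) : ℤ :=
  m 0 1 * (m 2 3 * m 4 5 - m 2 4 * m 3 5 + m 2 5 * m 3 4) -
  m 0 2 * (m 1 3 * m 4 5 - m 1 4 * m 3 5 + m 1 5 * m 3 4) +
  m 0 3 * (m 1 2 * m 4 5 - m 1 4 * m 2 5 + m 1 5 * m 2 4) -
  m 0 4 * (m 1 2 * m 3 5 - m 1 3 * m 2 5 + m 1 5 * m 2 3) +
  m 0 5 * (m 1 2 * m 3 4 - m 1 3 * m 2 4 + m 1 4 * m 2 3)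

/-- The Pfaffian of the Gram matrix of six vectors, as a multilinear map. -/
def pfaffianMultilinear {V : Type*} [AddCommGroup V] (ω : V →+ V →+ ℤ) :
    MultilinearMap ℤ (fun _ : Fin 6 => V) ℤ :=
  MultilinearMap.mk' (fun v => pf₆ fun i j => ω (v i) (v j))
    (fun v i x y => by fin_cases i <;> simp [pf₆] <;> ring)
    (fun v i c x => by fin_cases i <;> simp [pf₆] <;> ring)

lemma pf₆_eq_zero {m : Fin 6 → Fin 6 → ℤ} (hm : ∀ i j, m i j = -m j i) {i j : Fin 6} (hij : i < j)
    (h : ∀ k, m i k = m j k) : pf₆ m = 0 := by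
  have hd (k : Fin 6) : m k k = 0 := by have := hm k k; omega
  have h' (k : Fin 6) : m k i = m k j := by rw [hm k i, hm k j, h]
  fin_cases i <;> fin_cases j <;> first | exact absurd hij (by decide) | skip
  all_goals
    simp only [Fin.reduceFinMk, Fin.zero_eta, Fin.mk_one] at h h'
    simp only [pf₆, h, h', hd, hm 2 1, hm 3 1, hm 4 1,
      hm 5 1, hm 3 2, hm 4 2, hm 5 2, hm 4 3, hm 5 3, hm 5 4]
    ring

/-- The Pfaffian of the Gram matrix of six vectors, as an alternating map. -/
def pfaffianMap {V : Type*} [AddCommGroup V] (ω : V →+ V →+ ℤ) (hω : ∀ v w, ω v w = -ω w v) :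
    V [⋀^Fin 6]→ₗ[ℤ] ℤ where
  toMultilinearMap := pfaffianMultilinear ω
  map_eq_zero_of_eq' v i j h hij := by
    show pf₆ (fun i j => ω (v i) (v j)) = 0
    rcases lt_or_gt_of_ne hij with hlt | hlt
    · exact pf₆_eq_zero (fun _ _ => hω _ _) hlt fun k => by rw [h]
    · exact pf₆_eq_zero (fun _ _ => hω _ _) hlt fun k => by rw [h]

lemma pfaffianMap_apply {V : Type*} [AddCommGroup V] (ω : V →+ V →+ ℤ)
    (hω : ∀ v w, ω v w = -ω w v) (v : Fin 6 → V) :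
    pfaffianMap ω hω v = pf₆ fun i j => ω (v i) (v j) := rfl

lemma basisFun_det_col {n : Type*} [Fintype n] [DecidableEq n] (P : Matrix n n ℤ) :
    (Pi.basisFun ℤ n).det P.col = P.det := by
  rw [Pi.basisFun_det]
  exact Matrix.det_transpose P

/-- As an alternating function of six vectors, the Pfaffian of the Gram matrix is a multiple of the
determinant; the standard basis gives the factor. -/
lemma pf₆_conj (W P : Matrix (Fin 6) (Fin 6) ℤ) (hW : W.transpose = -W) :
    pf₆ (P.transpose * W * P) = P.det * pf₆ W := by
  let L : (Fin 6 → ℤ) →ₗ[ℤ] (Fin 6 → ℤ) →ₗ[ℤ] ℤ := Matrix.toLinearMap₂' ℤ W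
  let ω : (Fin 6 → ℤ) →+ (Fin 6 → ℤ) →+ ℤ :=
    AddMonoidHom.mk' (fun v => (L v).toAddMonoidHom) fun v w => by ext; simp
  have hω_apply (v w : Fin 6 → ℤ) : ω v w = dotProduct v (W.mulVec w) :=
    Matrix.toLinearMap₂'_apply' _ v w
  have hω (v w : Fin 6 → ℤ) : ω v w = -ω w v := by
    rw [hω_apply, hω_apply, dotProduct_comm, ← Matrix.vecMul_transpose, hW, Matrix.vecMul_neg,
      neg_dotProduct, ← Matrix.dotProduct_mulVec]
  have key := (pfaffianMap ω hω).eq_smul_basis_det (Pi.basisFun ℤ (Fin 6))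
  have h1 : pfaffianMap ω hω P.col = pf₆ (P.transpose * W * P) :=
    by rw [pfaffianMap_apply]; congr 1; ext k l; rw [transpose_mul_mul_apply, hω_apply]
  have h2 : pfaffianMap ω hω (Pi.basisFun ℤ (Fin 6)) = pf₆ W :=
    by rw [pfaffianMap_apply]; congr 1; ext k l; simp [hω_apply]
  rw [← h1, key, AlternatingMap.smul_apply, h2, basisFun_det_col, smul_eq_mul, mul_comm]

lemma transpose_normalMatrix (a b c : ℤ) :
    (normalMatrix a b c).transpose = -normalMatrix a b c := by
  ext i j
  fin_cases i <;> fin_cases j <;> simp [normalMatrix]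

lemma dotProduct_normalMatrix_mulVec (a b c : ℤ) (v w : Fin 6 → ℤ) :
    dotProduct v ((normalMatrix a b c).mulVec w) = a * (v 0 * w 1 - v 1 * w 0) +
      b * (v 2 * w 3 - v 3 * w 2) + c * (v 4 * w 5 - v 5 * w 4) := by
  simp [normalMatrix, dotProduct, Matrix.mulVec, Fin.sum_univ_succ]
  ring

lemma pf₆_normalMatrix (a b c : ℤ) : pf₆ (normalMatrix a b c) = a * b * c := by
  simp [pf₆, normalMatrix]
  ring

/-- The form is `aX + bY + cZ` with `X`, `Y`, `Z` decomposable. Their Plücker relations remove the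
terms in `a²`, `b²`, `c²`, leaving multiples of `ab`, `ac` and `bc`. -/
lemma mul_dvd_pf₄ {a b c : ℤ} (hab : a ∣ b) (hbc : b ∣ c) (v : Fin 4 → Fin 6 → ℤ) :
    a * b ∣ pf₄ fun i j => dotProduct (v i) ((normalMatrix a b c).mulVec (v j)) := by
  let X (i j : Fin 4) : ℤ := v i 0 * v j 1 - v i 1 * v j 0
  let Y (i j : Fin 4) : ℤ := v i 2 * v j 3 - v i 3 * v j 2
  let Z (i j : Fin 4) : ℤ := v i 4 * v j 5 - v i 5 * v j 4
  let Q (X Y : Fin 4 → Fin 4 → ℤ) : ℤ := X 0 1 * Y 2 3 + Y 0 1 * X 2 3 -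
    (X 0 2 * Y 1 3 + Y 0 2 * X 1 3) + (X 0 3 * Y 1 2 + Y 0 3 * X 1 2)
  have hX : X 0 1 * X 2 3 - X 0 2 * X 1 3 + X 0 3 * X 1 2 = 0 := by simp only [X]; ring
  have hY : Y 0 1 * Y 2 3 - Y 0 2 * Y 1 3 + Y 0 3 * Y 1 2 = 0 := by simp only [Y]; ring
  have hZ : Z 0 1 * Z 2 3 - Z 0 2 * Z 1 3 + Z 0 3 * Z 1 2 = 0 := by simp only [Z]; ring
  have h (i j : Fin 4) : dotProduct (v i) ((normalMatrix a b c).mulVec (v j)) =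
      a * X i j + b * Y i j + c * Z i j := dotProduct_normalMatrix_mulVec ..
  have e : (pf₄ fun i j => dotProduct (v i) ((normalMatrix a b c).mulVec (v j))) =
      a * b * Q X Y + a * c * Q X Z + b * c * Q Y Z := by
    simp only [pf₄, h, Q]
    linear_combination a ^ 2 * hX + b ^ 2 * hY + c ^ 2 * hZ
  rw [e]
  refine dvd_add (dvd_add (dvd_mul_right _ _) ?_) ?_
  · exact (mul_dvd_mul_left a hbc).mul_right _
  · exact (mul_dvd_mul hab hbc).mul_right _

lemma dvd_dotProduct_normalMatrix {a b c : ℤ} (hab : a ∣ b) (hbc : b ∣ c) (v w : Fin 6 → ℤ) :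
    a ∣ dotProduct v ((normalMatrix a b c).mulVec w) := by
  rw [dotProduct_normalMatrix_mulVec]
  exact dvd_add (dvd_add (dvd_mul_right _ _) (hab.mul_right _)) ((hab.trans hbc).mul_right _)

/-- Entries, the leading `4 × 4` Pfaffian and the full Pfaffian are compared in turn. The last
acquires the factor `(det P)⁴ = 1`, so the product is preserved with its sign. -/
lemma dvd_of_normalMatrix_eq {a b c a' b' c' : ℤ} (hab : a ∣ b) (hbc : b ∣ c)
    {P : Matrix (Fin 6) (Fin 6) ℤ} (hP : IsUnit P.det)
    (h : P.det • (P.transpose * normalMatrix a b c * P) = normalMatrix a' b' c') :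
    a ∣ a' ∧ a * b ∣ a' * b' ∧ a * b * c = a' * b' * c' := by
  have hP2 : P.det * P.det = 1 := Int.isUnit_mul_self hP
  have hentry (k l : Fin 6) : normalMatrix a' b' c' k l =
      P.det * dotProduct (P.col k) ((normalMatrix a b c).mulVec (P.col l)) := by
    rw [← h, Matrix.smul_apply, transpose_mul_mul_apply, smul_eq_mul]
  refine ⟨?_, ?_, ?_⟩
  · have h01 : normalMatrix a' b' c' 0 1 = a' := rfl
    rw [← h01, hentry]
    exact (dvd_dotProduct_normalMatrix hab hbc _ _).mul_left _
  · have := mul_dvd_pf₄ hab hbc fun i => P.col (Fin.castLE (by norm_num) i)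
    refine this.trans (dvd_of_eq ?_)
    have e (i j : Fin 4) : dotProduct (P.col (Fin.castLE (by norm_num) i))
        ((normalMatrix a b c).mulVec (P.col (Fin.castLE (by norm_num) j))) =
        P.det * normalMatrix a' b' c' (Fin.castLE (by norm_num) i) (Fin.castLE (by norm_num) j) := by
      rw [hentry, ← mul_assoc, hP2, one_mul]
    simp only [pf₄, e]
    simp [normalMatrix, Fin.castLE]
    linear_combination (a' * b') * hP2
  · have h6 := pf₆_conj (normalMatrix a b c) P (transpose_normalMatrix a b c)
    have h6' : pf₆ (normalMatrix a' b' c') =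
        P.det * P.det * P.det * pf₆ (P.transpose * normalMatrix a b c * P) := by
      rw [← h]
      simp only [pf₆, Matrix.smul_apply, smul_eq_mul]
      ring
    rw [h6, pf₆_normalMatrix, pf₆_normalMatrix] at h6'
    rw [h6']
    linear_combination (-(a * b * c) * (P.det * P.det + 1)) * hP2

/-- Divisibility both ways and nonnegativity give `a = a'` and `a * b = a' * b'`; cancellation does
the rest, and a zero coefficient forces all later ones to vanish. -/
theorem normalMatrix_injective {a b c a' b' c' : ℤ} (hab : a ∣ b) (hbc : b ∣ c) (hab' : a' ∣ b')
    (hbc' : b' ∣ c') (ha : 0 ≤ a) (hb : 0 ≤ b) (ha' : 0 ≤ a') (hb' : 0 ≤ b')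
    {P Q : Matrix (Fin 6) (Fin 6) ℤ} (hP : IsUnit P.det) (hQ : IsUnit Q.det)
    (h : P.det • (P.transpose * normalMatrix a b c * P) = normalMatrix a' b' c')
    (h' : Q.det • (Q.transpose * normalMatrix a' b' c' * Q) = normalMatrix a b c) :
    a = a' ∧ b = b' ∧ c = c' := by
  obtain ⟨h1, h2, h3⟩ := dvd_of_normalMatrix_eq hab hbc hP h
  obtain ⟨h1', h2', -⟩ := dvd_of_normalMatrix_eq hab' hbc' hQ h'
  obtain rfl := Int.dvd_antisymm ha ha' h1 h1'
  have h4 := Int.dvd_antisymm (mul_nonneg ha hb) (mul_nonneg ha hb') h2 h2'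
  rcases eq_or_ne a 0 with rfl | ha0
  · obtain rfl := zero_dvd_iff.1 hab
    obtain rfl := zero_dvd_iff.1 hab'
    exact ⟨rfl, rfl, (zero_dvd_iff.1 hbc).trans (zero_dvd_iff.1 hbc').symm⟩
  obtain rfl := mul_left_cancel₀ ha0 h4
  rcases eq_or_ne b 0 with rfl | hb0
  · exact ⟨rfl, rfl, (zero_dvd_iff.1 hbc).trans (zero_dvd_iff.1 hbc').symm⟩
  exact ⟨rfl, rfl, mul_left_cancel₀ (mul_ne_zero ha0 hb0) h3⟩

/-! ## Poincaré duality for `ℤ⁶` in degree four -/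

lemma ev_sum_mul {G : Type} [Group G] {n : ℕ} {ι : Type*} [Fintype ι] (c : ι → ℤ)
    (ψ : ι → (Fin n → G) → ℤ) (z : (Fin n → G) →₀ ℤ) :
    ev (fun g => ∑ i, c i * ψ i g) z = ∑ i, c i * ev (ψ i) z := by
  simp only [ev, Finsupp.linearCombination_apply, Finsupp.sum, smul_eq_mul, Finset.mul_sum]
  rw [Finset.sum_comm]
  exact Finset.sum_congr rfl fun i _ => Finset.sum_congr rfl fun g _ => by ring

lemma cocls_congr {G : Type} [Group G] {n : ℕ} {φ φ' : (Fin n → G) → ℤ} (h : cobd n φ = 0)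
    (h' : cobd n φ' = 0) (e : φ = φ') : cocls n φ h = cocls n φ' h' := by
  subst e
  rfl

section

variable {n : ℕ} (γ : Module.Basis (Fin n) ℤ (Fin n → ℤ))

/-- The homomorphism `ℤⁿ → ℤ` with given coefficients in the basis dual to `γ`. -/
def dualHom (c : Fin n → ℤ) : Additive (Zn n) →+ ℤ :=
  AddMonoidHom.mk' (fun v => dotProduct c (γ.repr v.toMul.toAdd)) fun v w => by
    rw [← dotProduct_add]
    congr 1
    ext i
    simp

lemma dualHom_apply (c v : Fin n → ℤ) :
    dualHom γ c (Additive.ofMul (Multiplicative.ofAdd v)) = dotProduct c (γ.repr v) := rfl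

lemma dualHom_basis (c : Fin n → ℤ) (i : Fin n) :
    dualHom γ c (Additive.ofMul (Multiplicative.ofAdd (γ i))) = c i := by
  simp [dualHom_apply, Finsupp.single_eq_pi_single]

lemma dualClass_eq (i : Fin n) : dualClass γ i = cocls 1 _ (cobd_hom (dualHom γ (Pi.single i 1))) := by
  refine cocls_congr _ _ (funext fun g => ?_)
  refine Eq.trans ?_ (dualHom_apply γ _ _).symm
  simp
  rfl

lemma dualHom_comp_aut (A : (Fin n → ℤ) ≃+ (Fin n → ℤ)) (c : Fin n → ℤ) :
    (dualHom γ c).comp (MonoidHom.toAdditive (AddMonoidHom.toMultiplicative A.toAddMonoidHom)) =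
      dualHom γ (Matrix.vecMul c (LinearMap.toMatrix γ γ A.toAddMonoidHom.toIntLinearMap)) := by
  refine AddMonoidHom.ext fun v => ?_
  show dotProduct c (γ.repr (A.toAddMonoidHom.toIntLinearMap v.toMul.toAdd)) =
    dotProduct (Matrix.vecMul c _) (γ.repr v.toMul.toAdd)
  rw [← Matrix.dotProduct_mulVec, LinearMap.toMatrix_mulVec_repr]

end

variable (γ : Module.Basis (Fin 6) ℤ (Fin 6 → ℤ))

/-- The cocycle `∑ᵢⱼ Uᵢⱼ xᵢ ∪ xⱼ`. -/
def quadCochain (U : Matrix (Fin 6) (Fin 6) ℤ) : (Fin 2 → Zn 6) → ℤ :=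
  ∑ p : Fin 6 × Fin 6, U p.1 p.2 • cupCochain (p := 1) (q := 1) rfl
    (fun g => dualHom γ (Pi.single p.1 1) (Additive.ofMul (g 0)))
    (fun g => dualHom γ (Pi.single p.2 1) (Additive.ofMul (g 0)))

lemma cobd_quadCochain (U : Matrix (Fin 6) (Fin 6) ℤ) : cobd 2 (quadCochain γ U) = 0 := by
  rw [quadCochain, map_sum]
  refine Finset.sum_eq_zero fun p _ => ?_
  exact cobd_smul_eq_zero _ (cobd_cupCochain_eq_zero _ (cobd_hom _) (cobd_hom _))

/-- The class `(∑ᵢⱼ Uᵢⱼ xᵢ xⱼ) ∩ [T]`. -/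
def quadClass (U : Matrix (Fin 6) (Fin 6) ℤ) : H 4 (Zn 6) :=
  cap (p := 2) (q := 4) (n := 6) rfl (cocls 2 (quadCochain γ U) (cobd_quadCochain γ U))
    (fundamentalClass γ)

/-- Evaluation of a product of four classes in `H¹`, given by coefficients in the dual basis. -/
def coordPairing (F : Fin 4 → Fin 6 → ℤ) : H 4 (Zn 6) →+ ℤ :=
  prodPairing fun k => dualHom γ (F k)

/-- Evaluating on a cap product amounts to evaluating the cup product on `[T]`, and each product of
six degree-one classes gives a determinant there. -/
lemma coordPairing_quadClass (U : Matrix (Fin 6) (Fin 6) ℤ) (F : Fin 4 → Fin 6 → ℤ) :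
    coordPairing γ F (quadClass γ U) = quadDet U F := by
  rw [quadClass, fundamentalClass, pontryagin, cap_cls, coordPairing, prodPairing, pairing_cls,
    ← ev_cupCochain]
  have h : cupCochain (p := 2) (q := 4) (n := 6) rfl (quadCochain γ U)
      (prodCochain fun k => dualHom γ (F k)) = fun g => ∑ p : Fin 6 × Fin 6, U p.1 p.2 *
        prodCochain (fun a : Fin 6 => dualHom γ
          (Matrix.vecCons (Pi.single p.1 1) (Matrix.vecCons (Pi.single p.2 1) F) a)) g := by
    funext g
    simp only [cupCochain, quadCochain, Finset.sum_apply, Pi.smul_apply, smul_eq_mul,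
      Finset.sum_mul, mul_assoc]
    refine Finset.sum_congr rfl fun p _ => ?_
    congr 1
  rw [h, ev_sum_mul, quadDet, Fintype.sum_prod_type]
  refine Finset.sum_congr rfl fun i _ => Finset.sum_congr rfl fun j _ => ?_
  rw [ev_prodCochain_pontryaginChain, consDet_apply]
  simp only [dualHom_basis]

lemma exists_jointly_injective : ∃ r : H 4 (Zn 6) →+ ({p : Fin 6 × Fin 6 // p.1 < p.2} → ℤ),
    Function.Injective r ∧ (∀ y, ∃ U, r (quadClass γ U) = y) ∧
      ∀ x y, (∀ F, coordPairing γ F x = coordPairing γ F y) → r x = r y := by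
  choose F δ hδ hF using fun p : {p : Fin 6 × Fin 6 // p.1 < p.2} => exists_quadDet_eq p.2.ne
  let r : H 4 (Zn 6) →+ ({p : Fin 6 × Fin 6 // p.1 < p.2} → ℤ) :=
    AddMonoidHom.mk' (fun x p => coordPairing γ (F p) x) fun x y => funext fun p => map_add _ x y
  have hr (x : H 4 (Zn 6)) (p) : r x p = coordPairing γ (F p) x := rfl
  have hsurj (y : {p : Fin 6 × Fin 6 // p.1 < p.2} → ℤ) : ∃ U, r (quadClass γ U) = y := by
    -- The factor `δ` cancels the sign from `exists_quadDet_eq`, as `δ * δ = 1`.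
    refine ⟨Matrix.of fun i j => if h : i < j then δ ⟨(i, j), h⟩ * y ⟨(i, j), h⟩ else 0, ?_⟩
    funext p
    rw [hr, coordPairing_quadClass, hF]
    simp only [Matrix.of_apply, dif_pos p.2, dif_neg p.2.not_gt, sub_zero]
    rw [← mul_assoc, Int.isUnit_mul_self (hδ p), one_mul]
  refine ⟨r, ?_, hsurj, fun x y h => funext fun p => h (F p)⟩
  obtain ⟨g, hg⟩ := generatedBy_H 6 4
  have hcard : Fintype.card {p : Fin 6 × Fin 6 // p.1 < p.2} = Nat.choose 6 4 := by decide
  let e := LinearEquiv.funCongrLeft ℤ ℤ (Fintype.equivFinOfCardEq hcard).symm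
  let s : (Fin (Nat.choose 6 4) → ℤ) →ₗ[ℤ] (Fin (Nat.choose 6 4) → ℤ) :=
    e ∘ₗ (r.comp g).toIntLinearMap
  have hs : Function.Surjective s := by
    refine Function.Surjective.comp (f := r.comp g) e.surjective fun y => ?_
    obtain ⟨U, hU⟩ := hsurj y
    obtain ⟨w, hw⟩ := hg (quadClass γ U)
    exact ⟨w, (congrArg r hw).trans hU⟩
  -- The composite `ℤ¹⁵ → H 4 (Zn 6) → ℤ¹⁵` is onto, hence injective; its first map being onto, the
  -- second is injective.
  have hs' := OrzechProperty.injective_of_surjective_endomorphism s hs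
  intro x y hxy
  obtain ⟨v, rfl⟩ := hg x
  obtain ⟨w, rfl⟩ := hg y
  rw [hs' (congrArg e hxy : s v = s w)]

lemma coordPairing_injective {x y : H 4 (Zn 6)}
    (h : ∀ F, coordPairing γ F x = coordPairing γ F y) : x = y := by
  obtain ⟨r, hr, -, hr'⟩ := exists_jointly_injective γ
  exact hr (hr' x y h)

lemma exists_quadClass_eq (x : H 4 (Zn 6)) : ∃ U, quadClass γ U = x := by
  obtain ⟨r, hr, hs, -⟩ := exists_jointly_injective γ
  obtain ⟨U, hU⟩ := hs (r x)
  exact ⟨U, hr hU⟩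

lemma quadClass_eq_iff (U V : Matrix (Fin 6) (Fin 6) ℤ) :
    quadClass γ U = quadClass γ V ↔ U - U.transpose = V - V.transpose := by
  constructor
  · intro h
    ext i j
    rcases eq_or_ne i j with rfl | hij
    · simp
    obtain ⟨F, δ, hδ, hF⟩ := exists_quadDet_eq hij
    have := congrArg (coordPairing γ F) h
    rw [coordPairing_quadClass, coordPairing_quadClass, hF, hF] at this
    exact mul_left_cancel₀ hδ.ne_zero this
  · intro h
    refine coordPairing_injective γ fun F => ?_
    have := congrArg (quadDet · F) h
    simp only [quadDet_sub, quadDet_transpose] at this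
    rw [coordPairing_quadClass, coordPairing_quadClass]
    linarith

/-! ### The action of automorphisms as twisted congruence -/

lemma coordPairing_autMap (A : (Fin 6 → ℤ) ≃+ (Fin 6 → ℤ)) (F : Fin 4 → Fin 6 → ℤ)
    (x : H 4 (Zn 6)) : coordPairing γ F (autMap A 4 x) = coordPairing γ (fun k => Matrix.vecMul (F k)
      (LinearMap.toMatrix γ γ A.toAddMonoidHom.toIntLinearMap)) x := by
  rw [coordPairing, coordPairing, autMap, prodPairing_pushforward]
  simp only [dualHom_comp_aut]

/-- Both sides have equal pairings: pushing forward replaces `F` by `F M`, with `M` the matrix of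
`A`, and `quadDet_conj` compensates at the cost of `det P`, whose square is `1`. -/
lemma autMap_quadClass (A : (Fin 6 → ℤ) ≃+ (Fin 6 → ℤ)) (P U : Matrix (Fin 6) (Fin 6) ℤ)
    (hP : LinearMap.toMatrix γ γ A.toAddMonoidHom.toIntLinearMap * P = 1) :
    autMap A 4 (quadClass γ U) = quadClass γ (P.det • (P.transpose * U * P)) := by
  refine coordPairing_injective γ fun F => ?_
  set M := LinearMap.toMatrix γ γ A.toAddMonoidHom.toIntLinearMap with hM
  have hdet : P.det * P.det = 1 := by
    refine Int.isUnit_mul_self (IsUnit.of_mul_eq_one M.det ?_)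
    rw [mul_comm, ← Matrix.det_mul, hP, Matrix.det_one]
  have hF : F = fun k => Matrix.vecMul (Matrix.vecMul (F k) M) P := by
    funext k
    rw [Matrix.vecMul_vecMul, hP, Matrix.vecMul_one]
  rw [coordPairing_autMap, coordPairing_quadClass, coordPairing_quadClass, quadDet_smul]
  conv_rhs => rw [hF]
  rw [quadDet_conj, ← mul_assoc, hdet, one_mul]

lemma exists_autMap_quadClass {P : Matrix (Fin 6) (Fin 6) ℤ} (hP : IsUnit P.det) :
    ∃ A : (Fin 6 → ℤ) ≃+ (Fin 6 → ℤ), ∀ U, autMap A 4 (quadClass γ U) =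
      quadClass γ (P.det • (P.transpose * U * P)) := by
  have hP' : IsUnit P⁻¹.det := Matrix.isUnit_nonsing_inv_det P hP
  refine ⟨(Matrix.toLinearEquiv γ P⁻¹ hP').toAddEquiv, fun U => autMap_quadClass γ _ P U ?_⟩
  have : LinearMap.toMatrix γ γ
      ((Matrix.toLinearEquiv γ P⁻¹ hP').toAddEquiv.toAddMonoidHom.toIntLinearMap) = P⁻¹ :=
    (LinearMap.toMatrix_toLin γ γ P⁻¹ :)
  rw [this, Matrix.nonsing_inv_mul P hP]

lemma exists_matrix_of_aut (A : (Fin 6 → ℤ) ≃+ (Fin 6 → ℤ)) :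
    ∃ P : Matrix (Fin 6) (Fin 6) ℤ, IsUnit P.det ∧ ∀ U, autMap A 4 (quadClass γ U) =
      quadClass γ (P.det • (P.transpose * U * P)) := by
  let P := LinearMap.toMatrix γ γ A.symm.toAddMonoidHom.toIntLinearMap
  have hP : LinearMap.toMatrix γ γ A.toAddMonoidHom.toIntLinearMap * P = 1 := by
    rw [← LinearMap.toMatrix_comp, ← LinearMap.toMatrix_id γ]
    exact congrArg (LinearMap.toMatrix γ γ) (LinearMap.ext fun v => A.apply_symm_apply v)
  refine ⟨P, IsUnit.of_mul_eq_one (LinearMap.toMatrix γ γ A.toAddMonoidHom.toIntLinearMap).det ?_,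
    fun U => autMap_quadClass γ A P U hP⟩
  rw [mul_comm, ← Matrix.det_mul, hP, Matrix.det_one]

/-- The matrix of coefficients of `a x₁x₂ + b x₃x₄ + c x₅x₆`. -/
def upperNormalMatrix (a b c : ℤ) : Matrix (Fin 6) (Fin 6) ℤ :=
  !![0, a, 0, 0, 0, 0; 0, 0, 0, 0, 0, 0; 0, 0, 0, b, 0, 0; 0, 0, 0, 0, 0, 0;
    0, 0, 0, 0, 0, c; 0, 0, 0, 0, 0, 0]

lemma upperNormalMatrix_sub_transpose (a b c : ℤ) :
    upperNormalMatrix a b c - (upperNormalMatrix a b c).transpose = normalMatrix a b c := by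
  ext i j
  fin_cases i <;> fin_cases j <;> simp [upperNormalMatrix, normalMatrix]

lemma cap_eq_quadClass (a b c : ℤ) :
    cap (p := 2) (q := 4) (n := 6) rfl
      (a • cup (p := 1) (q := 1) (n := 2) rfl (dualClass γ 0) (dualClass γ 1) +
        b • cup (p := 1) (q := 1) (n := 2) rfl (dualClass γ 2) (dualClass γ 3) +
        c • cup (p := 1) (q := 1) (n := 2) rfl (dualClass γ 4) (dualClass γ 5))
      (fundamentalClass γ) = quadClass γ (upperNormalMatrix a b c) := by
  rw [quadClass]
  congr 1
  simp only [dualClass_eq, cup_cocls, ← cocls_smul, ← cocls_add]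
  refine cocls_congr _ _ ?_
  simp [quadCochain, Fintype.sum_prod_type, Fin.sum_univ_six, upperNormalMatrix]

lemma smul_conj_sub_transpose {n : Type*} [Fintype n] (c : ℤ) (P U : Matrix n n ℤ) :
    c • (P.transpose * U * P) - (c • (P.transpose * U * P)).transpose =
      c • (P.transpose * (U - U.transpose) * P) := by
  rw [Matrix.transpose_smul, ← smul_sub, Matrix.transpose_mul, Matrix.transpose_mul,
    Matrix.transpose_transpose, Matrix.mul_sub, Matrix.sub_mul, Matrix.mul_assoc, Matrix.mul_assoc]

/-- Twisted congruence is a group action, so two points of one orbit are related by `P⁻¹ * Q`. -/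
lemma exists_conj_of_conj {W N N' P Q : Matrix (Fin 6) (Fin 6) ℤ} (hP : IsUnit P.det)
    (hQ : IsUnit Q.det) (h : P.det • (P.transpose * W * P) = N)
    (h' : Q.det • (Q.transpose * W * Q) = N') :
    ∃ R : Matrix (Fin 6) (Fin 6) ℤ, IsUnit R.det ∧ R.det • (R.transpose * N * R) = N' := by
  have hP' : IsUnit P⁻¹.det := Matrix.isUnit_nonsing_inv_det P hP
  have h1 : P * P⁻¹ = 1 := Matrix.mul_nonsing_inv P hP
  have h2 : P.det * P⁻¹.det = 1 := by rw [← Matrix.det_mul, h1, Matrix.det_one]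
  refine ⟨P⁻¹ * Q, by rw [Matrix.det_mul]; exact hP'.mul hQ, ?_⟩
  have h3 : (P⁻¹ * Q).transpose * (P.transpose * W * P) * (P⁻¹ * Q) = Q.transpose * W * Q := by
    calc _ = Q.transpose * (P * P⁻¹).transpose * W * (P * P⁻¹) * Q := by
          simp only [Matrix.transpose_mul, Matrix.mul_assoc]
      _ = _ := by rw [h1]; simp
  rw [← h, ← h', Matrix.mul_smul, Matrix.smul_mul, h3, smul_smul, Matrix.det_mul]
  congr 1
  linear_combination Q.det * h2

end TorusHomology
end

open TorusHomology
theorem mainTheorem11 (γ : Module.Basis (Fin 6) ℤ (Fin 6 → ℤ)) (α : H 4 (Zn 6)) :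
    ∃! t : ℤ × ℤ × ℤ,
      t.1 ∣ t.2.1 ∧ t.2.1 ∣ t.2.2 ∧ 0 ≤ t.1 ∧ 0 ≤ t.2.1 ∧
      ∃ A : (Fin 6 → ℤ) ≃+ (Fin 6 → ℤ),
        autMap A 4 α =
          cap (p := 2) (q := 4) (n := 6) rfl
            (t.1 • cup (p := 1) (q := 1) (n := 2) rfl (dualClass γ 0) (dualClass γ 1) +
              t.2.1 • cup (p := 1) (q := 1) (n := 2) rfl (dualClass γ 2) (dualClass γ 3) +
              t.2.2 • cup (p := 1) (q := 1) (n := 2) rfl (dualClass γ 4) (dualClass γ 5))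
            (fundamentalClass γ) := by
  obtain ⟨U, rfl⟩ := exists_quadClass_eq γ α
  simp only [cap_eq_quadClass]
  obtain ⟨P, a, b, c, hP, hab, hbc, ha, hb, hPU⟩ := exists_conj_eq_normalMatrix U
  have hP1 : IsUnit P.det := by rw [hP]; exact isUnit_one
  have hconj : P.det • (P.transpose * (U - U.transpose) * P) = normalMatrix a b c := by
    rw [hP, hPU, one_smul]
  obtain ⟨A, hA⟩ := exists_autMap_quadClass γ hP1
  refine ⟨(a, b, c), ⟨hab, hbc, ha, hb, A, ?_⟩, ?_⟩
  · rw [hA, quadClass_eq_iff, upperNormalMatrix_sub_transpose, smul_conj_sub_transpose, hconj]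
  · rintro ⟨a', b', c'⟩ ⟨hab', hbc', ha', hb', A', hA'⟩
    obtain ⟨Q, hQ, hQU⟩ := exists_matrix_of_aut γ A'
    rw [hQU, quadClass_eq_iff, upperNormalMatrix_sub_transpose, smul_conj_sub_transpose] at hA'
    -- Both normal forms are twisted congruent to `U - Uᵀ`, hence to each other in both directions.
    obtain ⟨R, hR, hRN⟩ := exists_conj_of_conj hP1 hQ hconj hA'
    obtain ⟨S, hS, hSN⟩ := exists_conj_of_conj hQ hP1 hA' hconj
    obtain ⟨rfl, rfl, rfl⟩ :=
      normalMatrix_injective hab hbc hab' hbc' ha hb ha' hb' hR hS hRN hSN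
    rfl
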